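/- Let $\overline M$ be a compact Riemann surface with boundary $\partial M$, every connected component of which meets $\partial M$ (for connected $\overline M$: $\partial M\neq\emptyset$), let $M=\overline M\setminus\partial M$, and fix a smooth positive $(1,1)$-form $\omega$ on $\overline M$, locally $\omega=\sqrt{-1}\,g\,dz\wedge d\bar z$ with $g>0$. For a complex Hilbert space $V$, let $\operatorname{End}V$ be the bounded linear operators on $V$ with the operator norm, $\operatorname{End}^+V$ the positive invertible ones, $\operatorname{End}^{\mathrm{self}}V$ the self-adjoint ones, and write $\|f\|_0=\sup_{x\in\overline M}\|f(x)\|$ for $f:\overline M\to\operatorname{End}V$. There is a function $C:\mathbb R\times\mathbb R\to\mathbb R$, depending only on $(\overline M,\omega)$, such that the following holds for every complex Hilbert space $V$ and every $0<\alpha<1$. Let $P\in C^{2,\alpha}(\overline M,\operatorname{End}^+V)$ be flat, i.e. its curvature $R^P=\bar\partial(P^{-1}\partial P)=P^{-1}(P_{z\bar z}-P_{\bar z}P^{-1}P_z)\,d\bar z\wedge dz$ vanishes on $M$, and let $L$ be the operator given in any local coordinate $z$ by $$Lh=\frac1g\left(h_{z\bar z}-P_{\bar z}P^{-1}h_z-h_{\bar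 z}P^{-1}P_z+P_{\bar z}P^{-1}hP^{-1}P_z\right).$$ Then every $h\in C^{2,\alpha}(\overline M,\operatorname{End}^{\mathrm{self}}V)$ with $h|_{\partial M}=0$ satisfies $$\|h\|_0\le C\left(\|P\|_0,\|P^{-1}\|_0\right)\|Lh\|_0 .$$ -/

import Mathlib

open scoped Manifold ContDiff NNReal Topology

/-- The closed upper half-plane `{z ∈ ℂ : 0 ≤ Im z}`, the local model of a Riemann surface with
boundary. -/
def ClosedHalfPlane : Type := {z : ℂ // 0 ≤ z.im}

instance : TopologicalSpace ClosedHalfPlane := inferInstanceAs (TopologicalSpace {z : ℂ // 0 ≤ z.im})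

theorem closedHalfPlane_range :
    Set.range (Subtype.val : {z : ℂ // 0 ≤ z.im} → ℂ) = {z : ℂ | 0 ≤ z.im} :=
  Subtype.range_val

/-- The inclusion of the closed upper half-plane in `ℂ`, as a model with corners over `ℂ`.
With this model, the condition `IsManifold halfPlaneModel ω M` says that the coordinate changes are
holomorphic up to the boundary (locally restrictions of holomorphic maps between open subsets of
`ℂ`), so that a Hausdorff `M` satisfying it is a Riemann surface with (possibly empty) boundary
`halfPlaneModel.boundary M`. -/
noncomputable def halfPlaneModel : ModelWithCorners ℂ ℂ ClosedHalfPlane where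
  toFun := Subtype.val
  invFun z := ⟨⟨z.re, max z.im 0⟩, le_max_right _ _⟩
  source := Set.univ
  target := {z : ℂ | 0 ≤ z.im}
  map_source' x _ := x.property
  map_target' _ _ := Set.mem_univ _
  left_inv' := fun ⟨_, hz⟩ _ => Subtype.ext (Complex.ext rfl (max_eq_left hz))
  right_inv' := fun _ hz => Complex.ext rfl (max_eq_left hz)
  source_eq := rfl
  convex_range' := by
    simp only [instIsRCLikeNormedField, ↓reduceDIte]
    apply Convex.convex_isRCLikeNormedField
    exact closedHalfPlane_range ▸ convex_halfSpace_im_ge 0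
  nonempty_interior' := by
    refine ⟨Complex.I, mem_interior.2 ⟨{z : ℂ | 0 < z.im}, ?_, ?_, ?_⟩⟩
    · exact fun z hz => ⟨⟨z, le_of_lt hz⟩, rfl⟩
    · exact isOpen_lt continuous_const Complex.continuous_im
    · simp
  continuous_toFun := continuous_subtype_val
  continuous_invFun := by
    have h : Continuous fun z : ℂ => (⟨z.re, max z.im 0⟩ : ℂ) := by
      have : (fun z : ℂ => (⟨z.re, max z.im 0⟩ : ℂ)) =
          fun z : ℂ => Complex.equivRealProdCLM.symm (z.re, max z.im 0) := rfl
      rw [this]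
      fun_prop
    exact h.subtype_mk _

section Local

variable {E : Type*} [NormedAddCommGroup E] [NormedSpace ℂ E]

/-- The Wirtinger derivative `f_z = (f_x - i f_y) / 2` of a function of `z = x + iy` in the closed
upper half-plane (at real points, the derivatives are those up to the boundary). -/
noncomputable def dz (f : ℂ → E) (z : ℂ) : E :=
  (1 / 2 : ℂ) • (fderivWithin ℝ f {w : ℂ | 0 ≤ w.im} z 1
    - Complex.I • fderivWithin ℝ f {w : ℂ | 0 ≤ w.im} z Complex.I)

/-- The Wirtinger derivative `f_z̄ = (f_x + i f_y) / 2`, in the same setting. -/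
noncomputable def dzbar (f : ℂ → E) (z : ℂ) : E :=
  (1 / 2 : ℂ) • (fderivWithin ℝ f {w : ℂ | 0 ≤ w.im} z 1
    + Complex.I • fderivWithin ℝ f {w : ℂ | 0 ≤ w.im} z Complex.I)

end Local

section Surface

variable {M : Type*} [TopologicalSpace M] [ChartedSpace ClosedHalfPlane M]

/-- The function `f` on `M`, written in the coordinate of the chart `e`. -/
noncomputable def inChart {E : Type*} (e : OpenPartialHomeomorph M ClosedHalfPlane) (f : M → E) :
    ℂ → E :=
  f ∘ (e.extend halfPlaneModel).symm

/-- `f` is of class `C^{k,α}` (up to the boundary): in every chart it is `C^k` in the real sense,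
and its derivatives of order `k` are locally `α`-Hölder continuous.  On a compact `M`, the local
condition amounts to the finiteness of the usual Hölder norms. -/
def IsHolderClass {E : Type*} [NormedAddCommGroup E] [NormedSpace ℂ E]
    (k : ℕ) (α : ℝ≥0) (f : M → E) : Prop :=
  ∀ e ∈ atlas ClosedHalfPlane M,
    ContDiffOn ℝ k (inChart e f) (e.extend halfPlaneModel).target ∧
    ∀ z ∈ (e.extend halfPlaneModel).target,
      ∃ u ∈ 𝓝[(e.extend halfPlaneModel).target] z, ∃ K : ℝ≥0,
        HolderOnWith K α
          (iteratedFDerivWithin ℝ k (inChart e f) (e.extend halfPlaneModel).target) u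

variable (M) in
/-- A smooth positive `(1,1)`-form on `M`, given by its local expressions
`√-1 g dz ∧ dz̄` in the charts `e` (`g = coeff e`): the functions `g` are smooth and positive, and
agree under changes of coordinates `w = τ(z)`, where `dw ∧ dw̄ = |τ'(z)|² dz ∧ dz̄`. -/
structure PositiveForm where
  /-- The local coefficient `g`. -/
  coeff : OpenPartialHomeomorph M ClosedHalfPlane → ℂ → ℝ
  smooth : ∀ e ∈ atlas ClosedHalfPlane M,
    ContDiffOn ℝ ∞ (coeff e) (e.extend halfPlaneModel).target
  pos : ∀ e ∈ atlas ClosedHalfPlane M, ∀ z ∈ (e.extend halfPlaneModel).target, 0 < coeff e z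
  compatible : ∀ e ∈ atlas ClosedHalfPlane M, ∀ e' ∈ atlas ClosedHalfPlane M,
    ∀ z ∈ ((e.extend halfPlaneModel).symm.trans (e'.extend halfPlaneModel)).source,
      coeff e z =
        ‖derivWithin ((e'.extend halfPlaneModel) ∘ (e.extend halfPlaneModel).symm)
            {w : ℂ | 0 ≤ w.im} z‖ ^ 2 *
          coeff e' (e'.extend halfPlaneModel ((e.extend halfPlaneModel).symm z))

/-- The sup norm `‖f‖₀` of a (bounded) function. -/
noncomputable def supNorm {E : Type*} [NormedAddCommGroup E] (f : M → E) : ℝ :=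
  ⨆ x, ‖f x‖

section Operators

variable {V : Type*} [NormedAddCommGroup V] [InnerProductSpace ℂ V] [CompleteSpace V]

/-- The coefficient `P⁻¹ (P_{z z̄} - P_z̄ P⁻¹ P_z)` of `dz̄ ∧ dz` in the curvature
`R^P = ∂̄(P⁻¹ ∂P)`, in the chart `e`. -/
noncomputable def curvatureCoeff (e : OpenPartialHomeomorph M ClosedHalfPlane)
    (P : M → V →L[ℂ] V) (z : ℂ) : V →L[ℂ] V :=
  Ring.inverse (inChart e P z) *
    (dzbar (dz (inChart e P)) z
      - dzbar (inChart e P) z * Ring.inverse (inChart e P z) * dz (inChart e P) z)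

/-- The metric `P` is flat: its curvature vanishes in the interior of `M`. -/
def IsFlat (P : M → V →L[ℂ] V) : Prop :=
  ∀ e ∈ atlas ClosedHalfPlane M, ∀ z ∈ (e.extend halfPlaneModel).target, 0 < z.im →
    curvatureCoeff e P z = 0

/-- The expression
`ℒh = h_{z z̄} - P_z̄ P⁻¹ h_z - h_z̄ P⁻¹ P_z + P_z̄ P⁻¹ h P⁻¹ P_z` in the chart `e`. -/
noncomputable def localL (e : OpenPartialHomeomorph M ClosedHalfPlane)
    (P h : M → V →L[ℂ] V) (z : ℂ) : V →L[ℂ] V :=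
  dzbar (dz (inChart e h)) z
    - dzbar (inChart e P) z * Ring.inverse (inChart e P z) * dz (inChart e h) z
    - dzbar (inChart e h) z * Ring.inverse (inChart e P z) * dz (inChart e P) z
    + dzbar (inChart e P) z * Ring.inverse (inChart e P z) * inChart e h z *
        Ring.inverse (inChart e P z) * dz (inChart e P) z

/-- The operator `Lh = √-1 Λ(∂̄∂h - A^* ∧ ∂h - ∂̄h ∧ A + A^* ∧ h ∧ A)`, `A = P⁻¹ ∂P`, where
`Λφ = -φ / Ω`.  In any chart it is `(1 / g) ℒh` if `Ω = √-1 g dz ∧ dz̄`; the value does not depend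
on the chart, and here the preferred chart at the point is used. -/
noncomputable def opL (Ω : PositiveForm M) (P h : M → V →L[ℂ] V) (x : M) : V →L[ℂ] V :=
  ((1 / Ω.coeff (chartAt ClosedHalfPlane x) (extChartAt halfPlaneModel x x) : ℝ) : ℂ) •
    localL (chartAt ClosedHalfPlane x) P h (extChartAt halfPlaneModel x x)

end Operators

end Surface

-- The estimate reduces to a scalar maximum principle. Let `s(x)` be the least `t` with `h(x) ≤ t
-- P(x)` as quadratic forms (`relBound`). In a parallel frame of a flat `P`, the operator `L`
-- becomes `(1/g) ∂²/∂z∂z̄`, so `s` should satisfy `(1/g) s_{z z̄} ≥ -c` with `c = ‖Lh‖₀ ‖P⁻¹‖₀`. As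
-- `s` is only upper semicontinuous, the inequality is read in the viscosity sense. The test
-- functions `Re F - |f|²`, with `F` and `f` holomorphic, have mixed derivative `-|f'|²` and form a
-- class stable under holomorphic changes of coordinate.
--
-- No parallel frame has to be constructed: at a given point `z` the first order frame `1 - (w - z)
-- P⁻¹P_z` already turns `L` into the mixed derivative (`dzbar_dz_conjugate_flat`). In infinite
-- dimension `s(x)` need not be attained by a vector, so the second derivative test uses four-point
-- differences controlled in operator norm, with almost extremal vectors
-- (`norm_deriv_sq_le_of_touching`).
--
-- On the scalar side there are `ε, κ > 0`, depending only on the surface and the form, such that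
-- every subsolution with constant `κ`, bounded by `1` and nonpositive on the boundary, is at most
-- `1 - ε` (`uniformlyBelow_univ`). The points near which such a bound holds form an open set, which
-- contains the boundary by a half-disc barrier and is closed by an annulus barrier; each component
-- meets the boundary, and compactness makes the constants uniform.
--
-- If `max s > c/κ`, then `s / max s` is such a subsolution and takes the value `1`, a
-- contradiction. Hence `h ≤ (c/κ) P`; the same for `-h` and self-adjointness give `‖h‖₀ ≤ (c/κ)
-- ‖P‖₀`, so that `C(a, b) = ab/κ`.

local notation "ℍ₀" => Set.ofPred (fun w : ℂ => 0 ≤ Complex.im w)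

/-! ### Wirtinger calculus up to the boundary of the half-plane -/

section Wirtinger

variable {E : Type*} [NormedAddCommGroup E] [NormedSpace ℂ E]

theorem uniqueDiffOn_halfPlane : UniqueDiffOn ℝ ℍ₀ :=
  uniqueDiffOn_convex (convex_halfSpace_im_ge 0)
    ⟨Complex.I, mem_interior.2 ⟨{z : ℂ | 0 < z.im}, fun _ hz => le_of_lt (Set.mem_ofPred.1 hz),
      isOpen_lt continuous_const Complex.continuous_im, by simp⟩⟩

theorem uniqueDiffOn_halfPlane_complex : UniqueDiffOn ℂ ℍ₀ := by
  have h := halfPlaneModel.uniqueDiffOn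
  have h2 : Set.range halfPlaneModel = ℍ₀ := closedHalfPlane_range
  rwa [h2] at h

theorem halfPlane_mem_nhds {z : ℂ} (hz : 0 < z.im) : ℍ₀ ∈ 𝓝 z :=
  Filter.mem_of_superset
    ((isOpen_lt continuous_const Complex.continuous_im).mem_nhds
      (show z ∈ {w : ℂ | 0 < w.im} from hz))
    fun _ hw => le_of_lt (Set.mem_ofPred.1 hw)

variable {f g : ℂ → E} {f' g' : ℂ →L[ℝ] E} {z : ℂ}

theorem HasFDerivWithinAt.dz_eq (hf : HasFDerivWithinAt f f' ℍ₀ z) (hz : z ∈ ℍ₀) :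
    dz f z = (1 / 2 : ℂ) • (f' 1 - Complex.I • f' Complex.I) := by
  rw [dz, hf.fderivWithin (uniqueDiffOn_halfPlane z hz)]

theorem HasFDerivWithinAt.dzbar_eq (hf : HasFDerivWithinAt f f' ℍ₀ z) (hz : z ∈ ℍ₀) :
    dzbar f z = (1 / 2 : ℂ) • (f' 1 + Complex.I • f' Complex.I) := by
  rw [dzbar, hf.fderivWithin (uniqueDiffOn_halfPlane z hz)]

theorem dz_congr (h : f =ᶠ[𝓝[ℍ₀] z] g) (hz : z ∈ ℍ₀) : dz f z = dz g z := by
  rw [dz, dz, h.fderivWithin_eq (h.eq_of_nhdsWithin hz)]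

theorem dzbar_congr (h : f =ᶠ[𝓝[ℍ₀] z] g) (hz : z ∈ ℍ₀) : dzbar f z = dzbar g z := by
  rw [dzbar, dzbar, h.fderivWithin_eq (h.eq_of_nhdsWithin hz)]

theorem dz_sub (hf : DifferentiableWithinAt ℝ f ℍ₀ z) (hg : DifferentiableWithinAt ℝ g ℍ₀ z)
    (hz : z ∈ ℍ₀) : dz (fun w => f w - g w) z = dz f z - dz g z := by
  refine ((hf.hasFDerivWithinAt.sub hg.hasFDerivWithinAt).dz_eq hz).trans ?_
  rw [dz, dz]
  simp only [_root_.sub_apply, smul_sub]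
  abel

theorem dzbar_sub (hf : DifferentiableWithinAt ℝ f ℍ₀ z) (hg : DifferentiableWithinAt ℝ g ℍ₀ z)
    (hz : z ∈ ℍ₀) : dzbar (fun w => f w - g w) z = dzbar f z - dzbar g z := by
  refine ((hf.hasFDerivWithinAt.sub hg.hasFDerivWithinAt).dzbar_eq hz).trans ?_
  rw [dzbar, dzbar]
  simp only [_root_.sub_apply, smul_sub, smul_add]
  abel

theorem dzbar_add (hf : DifferentiableWithinAt ℝ f ℍ₀ z) (hg : DifferentiableWithinAt ℝ g ℍ₀ z)
    (hz : z ∈ ℍ₀) : dzbar (fun w => f w + g w) z = dzbar f z + dzbar g z := by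
  refine ((hf.hasFDerivWithinAt.add hg.hasFDerivWithinAt).dzbar_eq hz).trans ?_
  rw [dzbar, dzbar]
  simp only [_root_.add_apply, smul_add]
  abel

theorem dz_smul {c : ℂ → ℂ} (hc : DifferentiableWithinAt ℝ c ℍ₀ z)
    (hf : DifferentiableWithinAt ℝ f ℍ₀ z) (hz : z ∈ ℍ₀) :
    dz (fun w => c w • f w) z = dz c z • f z + c z • dz f z := by
  refine ((hc.hasFDerivWithinAt.smul hf.hasFDerivWithinAt).dz_eq hz).trans ?_
  rw [dz, dz]
  simp only [_root_.add_apply, _root_.smul_apply,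
    ContinuousLinearMap.smulRight_apply]
  module

theorem dzbar_smul {c : ℂ → ℂ} (hc : DifferentiableWithinAt ℝ c ℍ₀ z)
    (hf : DifferentiableWithinAt ℝ f ℍ₀ z) (hz : z ∈ ℍ₀) :
    dzbar (fun w => c w • f w) z = dzbar c z • f z + c z • dzbar f z := by
  refine ((hc.hasFDerivWithinAt.smul hf.hasFDerivWithinAt).dzbar_eq hz).trans ?_
  rw [dzbar, dzbar]
  simp only [_root_.add_apply, _root_.smul_apply,
    ContinuousLinearMap.smulRight_apply]
  module

section Mul

variable {A : Type*} [NormedRing A] [NormedAlgebra ℂ A] {a b : ℂ → A}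

theorem dz_mul (ha : DifferentiableWithinAt ℝ a ℍ₀ z) (hb : DifferentiableWithinAt ℝ b ℍ₀ z)
    (hz : z ∈ ℍ₀) : dz (fun w => a w * b w) z = dz a z * b z + a z * dz b z := by
  refine ((ha.hasFDerivWithinAt.mul' hb.hasFDerivWithinAt).dz_eq hz).trans ?_
  rw [dz, dz]
  simp only [_root_.add_apply, _root_.smul_apply, smul_eq_mul,
    MulOpposite.smul_eq_mul_unop, MulOpposite.unop_op, smul_mul_assoc, mul_smul_comm, sub_mul,
    mul_sub, smul_sub, smul_add]
  abel

theorem dzbar_mul (ha : DifferentiableWithinAt ℝ a ℍ₀ z) (hb : DifferentiableWithinAt ℝ b ℍ₀ z)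
    (hz : z ∈ ℍ₀) : dzbar (fun w => a w * b w) z = dzbar a z * b z + a z * dzbar b z := by
  refine ((ha.hasFDerivWithinAt.mul' hb.hasFDerivWithinAt).dzbar_eq hz).trans ?_
  rw [dzbar, dzbar]
  simp only [_root_.add_apply, _root_.smul_apply, smul_eq_mul,
    MulOpposite.smul_eq_mul_unop, MulOpposite.unop_op, smul_mul_assoc, mul_smul_comm, add_mul,
    mul_add, smul_add]
  abel

end Mul

theorem dz_of_hasDerivWithinAt {a : E} (hf : HasDerivWithinAt f a ℍ₀ z) (hz : z ∈ ℍ₀) :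
    dz f z = a := by
  rw [(hf.hasFDerivWithinAt.restrictScalars ℝ).dz_eq hz]
  simp only [ContinuousLinearMap.coe_restrictScalars', ContinuousLinearMap.toSpanSingleton_apply,
    smul_smul, Complex.I_mul_I]
  module

theorem dzbar_of_hasDerivWithinAt {a : E} (hf : HasDerivWithinAt f a ℍ₀ z) (hz : z ∈ ℍ₀) :
    dzbar f z = 0 := by
  rw [(hf.hasFDerivWithinAt.restrictScalars ℝ).dzbar_eq hz]
  simp only [ContinuousLinearMap.coe_restrictScalars', ContinuousLinearMap.toSpanSingleton_apply,
    smul_smul, Complex.I_mul_I]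
  module

/-- `f_z̄` is the adjoint of `f_z` for a self-adjoint `f`, in a form suitable for any real-linear
conjugation `σ`. -/
theorem dz_conj_comp {F : Type*} [NormedAddCommGroup F] [NormedSpace ℂ F] (σ : E →L[ℝ] F)
    (hσ : ∀ (c : ℂ) v, σ (c • v) = (starRingEnd ℂ c) • σ v)
    (hf : DifferentiableWithinAt ℝ f ℍ₀ z) (hz : z ∈ ℍ₀) :
    dz (fun w => σ (f w)) z = σ (dzbar f z) := by
  refine ((σ.hasFDerivAt.comp_hasFDerivWithinAt z hf.hasFDerivWithinAt).dz_eq hz).trans ?_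
  rw [dzbar, hσ, map_add,
    hσ]
  simp [sub_eq_add_neg, Complex.conj_ofNat]

theorem dzbar_conj_comp {F : Type*} [NormedAddCommGroup F] [NormedSpace ℂ F] (σ : E →L[ℝ] F)
    (hσ : ∀ (c : ℂ) v, σ (c • v) = (starRingEnd ℂ c) • σ v)
    (hf : DifferentiableWithinAt ℝ f ℍ₀ z) (hz : z ∈ ℍ₀) :
    dzbar (fun w => σ (f w)) z = σ (dz f z) := by
  refine ((σ.hasFDerivAt.comp_hasFDerivWithinAt z hf.hasFDerivWithinAt).dzbar_eq hz).trans ?_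
  rw [dz, hσ, map_sub,
    hσ]
  simp [sub_eq_add_neg, Complex.conj_ofNat]

/-- Chain rule for the Wirtinger derivatives along a holomorphic map. -/
theorem dz_comp {τ : ℂ → ℂ} {a : ℂ} (hτ : HasDerivWithinAt τ a ℍ₀ z)
    (hm : ∀ᶠ w in 𝓝[ℍ₀] z, τ w ∈ ℍ₀) (hf : DifferentiableWithinAt ℝ f ℍ₀ (τ z)) (hz : z ∈ ℍ₀) :
    dz (f ∘ τ) z = a • dz f (τ z) ∧
      dzbar (f ∘ τ) z = (starRingEnd ℂ a) • dzbar f (τ z) := by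
  -- The composition is differentiated on `ℍ₀ ∩ τ⁻¹(ℍ₀)`, which is a neighbourhood of `z` within
  -- `ℍ₀`; this covers boundary points as well.
  have h : HasFDerivWithinAt (f ∘ τ) ((fderivWithin ℝ f ℍ₀ (τ z)).comp
      ((ContinuousLinearMap.toSpanSingleton ℂ a).restrictScalars ℝ)) ℍ₀ z := by
    have h1 := (hτ.hasFDerivWithinAt.restrictScalars ℝ).mono_of_mem_nhdsWithin
      (s := ℍ₀ ∩ τ ⁻¹' ℍ₀) (Filter.mem_of_superset self_mem_nhdsWithin (fun _ h => h.1))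
    have h2 := hf.hasFDerivWithinAt.comp z h1 (fun _ h => h.2)
    exact h2.mono_of_mem_nhdsWithin (Filter.inter_mem self_mem_nhdsWithin hm)
  set D := fderivWithin ℝ f ℍ₀ (τ z) with hD
  have e1 : D a = a.re • D 1 + a.im • D Complex.I := by
    rw [← map_smul, ← map_smul, ← map_add]
    congr 1
    apply Complex.ext <;> simp
  have e2 : D (Complex.I * a) = -a.im • D 1 + a.re • D Complex.I := by
    rw [← map_smul, ← map_smul, ← map_add]
    congr 1
    apply Complex.ext <;> simp
  have e3 : a = a.re + a.im * Complex.I := (Complex.re_add_im a).symm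
  have key : ∀ (r : ℝ) (v : E), r • v = (r : ℂ) • v := fun r v => (Complex.coe_smul r v).symm
  constructor
  · rw [h.dz_eq hz, dz, ← hD]
    simp only [ContinuousLinearMap.comp_apply, ContinuousLinearMap.coe_restrictScalars',
      ContinuousLinearMap.toSpanSingleton_apply, smul_eq_mul, one_mul, e1, e2, key]
    conv_rhs => rw [e3]
    push_cast
    match_scalars <;> ring_nf <;> (simp only [Complex.I_sq]; ring_nf)
  · rw [h.dzbar_eq hz, dzbar, ← hD]
    simp only [ContinuousLinearMap.comp_apply, ContinuousLinearMap.coe_restrictScalars',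
      ContinuousLinearMap.toSpanSingleton_apply, smul_eq_mul, one_mul, e1, e2, key]
    conv_rhs => rw [e3]
    simp only [map_add, map_mul, Complex.conj_ofReal, Complex.conj_I]
    push_cast
    match_scalars <;> ring_nf <;> (simp only [Complex.I_sq]; ring_nf)

theorem ContDiffWithinAt.dz {m n : WithTop ℕ∞} (hf : ContDiffWithinAt ℝ n f ℍ₀ z) (hmn : m + 1 ≤ n)
    (hz : z ∈ ℍ₀) : ContDiffWithinAt ℝ m (dz f) ℍ₀ z := by
  have h := hf.fderivWithin_right uniqueDiffOn_halfPlane hmn hz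
  exact ((h.clm_apply contDiffWithinAt_const).sub
    ((h.clm_apply contDiffWithinAt_const).const_smul Complex.I)).const_smul (1 / 2 : ℂ)

theorem ContDiffWithinAt.dzbar {m n : WithTop ℕ∞} (hf : ContDiffWithinAt ℝ n f ℍ₀ z)
    (hmn : m + 1 ≤ n) (hz : z ∈ ℍ₀) : ContDiffWithinAt ℝ m (dzbar f) ℍ₀ z := by
  have h := hf.fderivWithin_right uniqueDiffOn_halfPlane hmn hz
  exact ((h.clm_apply contDiffWithinAt_const).add
    ((h.clm_apply contDiffWithinAt_const).const_smul Complex.I)).const_smul (1 / 2 : ℂ)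

end Wirtinger

/-! ### Changes of coordinates and chart independence of the operator -/

section ChartChange

theorem range_halfPlaneModel : Set.range halfPlaneModel = ℍ₀ := closedHalfPlane_range

variable {M : Type*} [TopologicalSpace M]
  {e e' : OpenPartialHomeomorph M ClosedHalfPlane} {z : ℂ}

theorem extend_target_subset_halfPlane : (e.extend halfPlaneModel).target ⊆ ℍ₀ :=
  range_halfPlaneModel ▸ e.extend_target_subset_range

theorem extend_target_mem_nhdsWithin_halfPlane (hz : z ∈ (e.extend halfPlaneModel).target) :
    (e.extend halfPlaneModel).target ∈ 𝓝[ℍ₀] z := by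
  have h := e.extend_target_mem_nhdsWithin (I := halfPlaneModel)
    (y := (e.extend halfPlaneModel).symm z)
    (by simpa only [OpenPartialHomeomorph.extend_source] using
      (e.extend halfPlaneModel).map_target hz)
  rwa [(e.extend halfPlaneModel).right_inv hz, range_halfPlaneModel] at h

theorem coordChange_source_mem_nhdsWithin
    (hz : z ∈ (halfPlaneModel.extendCoordChange e e').source) :
    (halfPlaneModel.extendCoordChange e e').source ∈ 𝓝[ℍ₀] z :=
  range_halfPlaneModel ▸ halfPlaneModel.extendCoordChange_source_mem_nhdsWithin hz

theorem coordChange_mem_target (hz : z ∈ (halfPlaneModel.extendCoordChange e e').source) :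
    halfPlaneModel.extendCoordChange e e' z ∈ (e'.extend halfPlaneModel).target :=
  (e'.extend halfPlaneModel).map_source hz.2

theorem inChart_eq_comp_coordChange {E : Type*} (f : M → E)
    (hz : z ∈ (halfPlaneModel.extendCoordChange e e').source) :
    inChart e f z = (inChart e' f ∘ halfPlaneModel.extendCoordChange e e') z := by
  have h : (e'.extend halfPlaneModel).symm (e'.extend halfPlaneModel
      ((e.extend halfPlaneModel).symm z)) = (e.extend halfPlaneModel).symm z :=
    (e'.extend halfPlaneModel).left_inv hz.2
  change f _ = f ((e'.extend halfPlaneModel).symm (e'.extend halfPlaneModel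
      ((e.extend halfPlaneModel).symm z)))
  rw [h]

theorem eq_inChart_extend {E : Type*} (f : M → E) {x : M} (hx : x ∈ e.source) :
    inChart e f (e.extend halfPlaneModel x) = f x := by
  rw [inChart, Function.comp_apply, e.extend_left_inv hx]

theorem ContinuousOn.comp_extend {E : Type*} [TopologicalSpace E] {f : ℂ → E}
    (hf : ContinuousOn f (e.extend halfPlaneModel).target) :
    ContinuousOn (fun x => f (e.extend halfPlaneModel x)) e.source := by
  refine hf.comp ?_ ?_
  · simpa only [OpenPartialHomeomorph.extend_source] using
      (OpenPartialHomeomorph.continuousOn_extend e (I := halfPlaneModel))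
  · intro x hx
    exact (e.extend halfPlaneModel).map_source (by rwa [OpenPartialHomeomorph.extend_source])

variable [ChartedSpace ClosedHalfPlane M]

/-- Replaces the chart image by the half-plane, the set within which `dz` and `dzbar` differentiate.
-/
theorem IsHolderClass.contDiffWithinAt {E : Type*} [NormedAddCommGroup E] [NormedSpace ℂ E]
    {k : ℕ} {α : ℝ≥0} {f : M → E} (hf : IsHolderClass k α f) (he : e ∈ atlas ClosedHalfPlane M)
    (hz : z ∈ (e.extend halfPlaneModel).target) :
    ContDiffWithinAt ℝ k (inChart e f) ℍ₀ z :=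
  ((hf e he).1 z hz).mono_of_mem_nhdsWithin (extend_target_mem_nhdsWithin_halfPlane hz)

theorem IsHolderClass.continuous {E : Type*} [NormedAddCommGroup E] [NormedSpace ℂ E]
    {k : ℕ} {α : ℝ≥0} {f : M → E} (hf : IsHolderClass k α f) : Continuous f := by
  refine continuous_iff_continuousAt.2 fun x => ?_
  have h := ContinuousOn.comp_extend (hf _ (chart_mem_atlas ClosedHalfPlane x)).1.continuousOn
  have hx := mem_chart_source ClosedHalfPlane x
  refine (h.continuousAt ((chartAt ClosedHalfPlane x).open_source.mem_nhds hx)).congr ?_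
  filter_upwards [(chartAt ClosedHalfPlane x).open_source.mem_nhds hx] with y hy
  exact eq_inChart_extend f hy

variable [IsManifold halfPlaneModel ω M]

theorem contDiffWithinAt_coordChange (he : e ∈ atlas ClosedHalfPlane M)
    (he' : e' ∈ atlas ClosedHalfPlane M)
    (hz : z ∈ (halfPlaneModel.extendCoordChange e e').source) :
    ContDiffWithinAt ℂ ω (halfPlaneModel.extendCoordChange e e') ℍ₀ z :=
  range_halfPlaneModel ▸ halfPlaneModel.contDiffWithinAt_extendCoordChange
    (IsManifold.subset_maximalAtlas he) (IsManifold.subset_maximalAtlas he') hz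

theorem hasDerivWithinAt_coordChange (he : e ∈ atlas ClosedHalfPlane M)
    (he' : e' ∈ atlas ClosedHalfPlane M)
    (hz : z ∈ (halfPlaneModel.extendCoordChange e e').source) :
    HasDerivWithinAt (halfPlaneModel.extendCoordChange e e')
      (derivWithin (halfPlaneModel.extendCoordChange e e') ℍ₀ z) ℍ₀ z :=
  ((contDiffWithinAt_coordChange he he' hz).differentiableWithinAt (by simp)).hasDerivWithinAt

theorem differentiableWithinAt_derivWithin_coordChange (he : e ∈ atlas ClosedHalfPlane M)
    (he' : e' ∈ atlas ClosedHalfPlane M)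
    (hz : z ∈ (halfPlaneModel.extendCoordChange e e').source) :
    DifferentiableWithinAt ℂ (derivWithin (halfPlaneModel.extendCoordChange e e') ℍ₀) ℍ₀ z := by
  have h := (contDiffWithinAt_coordChange he he' hz).fderivWithin_right (m := 1)
    uniqueDiffOn_halfPlane_complex le_top (extend_target_subset_halfPlane hz.1)
  have h2 := (h.clm_apply (contDiffWithinAt_const (c := (1 : ℂ)))).differentiableWithinAt
    one_ne_zero
  exact h2

section Scalar

variable {E : Type*} [NormedAddCommGroup E] [NormedSpace ℂ E] {f : M → E}
  {α : ℝ≥0} (hf : IsHolderClass 2 α f)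

include hf

theorem dz_inChart_coordChange (he : e ∈ atlas ClosedHalfPlane M)
    (he' : e' ∈ atlas ClosedHalfPlane M)
    (hz : z ∈ (halfPlaneModel.extendCoordChange e e').source) :
    dz (inChart e f) z = derivWithin (halfPlaneModel.extendCoordChange e e') ℍ₀ z •
        dz (inChart e' f) (halfPlaneModel.extendCoordChange e e' z) ∧
      dzbar (inChart e f) z =
        starRingEnd ℂ (derivWithin (halfPlaneModel.extendCoordChange e e') ℍ₀ z) •
        dzbar (inChart e' f) (halfPlaneModel.extendCoordChange e e' z) := by
  have hzH := extend_target_subset_halfPlane hz.1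
  have hev : inChart e f =ᶠ[𝓝[ℍ₀] z] inChart e' f ∘ halfPlaneModel.extendCoordChange e e' := by
    filter_upwards [coordChange_source_mem_nhdsWithin hz] with w hw
    exact inChart_eq_comp_coordChange f hw
  rw [dz_congr hev hzH, dzbar_congr hev hzH]
  refine dz_comp (hasDerivWithinAt_coordChange he he' hz) ?_ ?_ hzH
  · filter_upwards [coordChange_source_mem_nhdsWithin hz] with w hw
    exact extend_target_subset_halfPlane (coordChange_mem_target hw)
  · exact (hf.contDiffWithinAt he' (coordChange_mem_target hz)).differentiableWithinAt (by simp)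

theorem dzbar_dz_inChart_coordChange (he : e ∈ atlas ClosedHalfPlane M)
    (he' : e' ∈ atlas ClosedHalfPlane M)
    (hz : z ∈ (halfPlaneModel.extendCoordChange e e').source) :
    dzbar (dz (inChart e f)) z =
      (derivWithin (halfPlaneModel.extendCoordChange e e') ℍ₀ z *
        starRingEnd ℂ (derivWithin (halfPlaneModel.extendCoordChange e e') ℍ₀ z)) •
        dzbar (dz (inChart e' f)) (halfPlaneModel.extendCoordChange e e' z) := by
  have hzH := extend_target_subset_halfPlane hz.1
  have hev : dz (inChart e f) =ᶠ[𝓝[ℍ₀] z] fun w =>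
      derivWithin (halfPlaneModel.extendCoordChange e e') ℍ₀ w •
        (dz (inChart e' f) ∘ halfPlaneModel.extendCoordChange e e') w := by
    filter_upwards [coordChange_source_mem_nhdsWithin hz] with w hw
    exact (dz_inChart_coordChange hf he he' hw).1
  have hd := differentiableWithinAt_derivWithin_coordChange he he' hz
  have hτ := hasDerivWithinAt_coordChange he he' hz
  have hmaps : ∀ᶠ w in 𝓝[ℍ₀] z, halfPlaneModel.extendCoordChange e e' w ∈ ℍ₀ := by
    filter_upwards [coordChange_source_mem_nhdsWithin hz] with w hw
    exact extend_target_subset_halfPlane (coordChange_mem_target hw)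
  have hdz : DifferentiableWithinAt ℝ (dz (inChart e' f)) ℍ₀
      (halfPlaneModel.extendCoordChange e e' z) :=
    ((hf.contDiffWithinAt he' (coordChange_mem_target hz)).dz (m := 1)
      (by norm_num [one_add_one_eq_two])
      (extend_target_subset_halfPlane (coordChange_mem_target hz))).differentiableWithinAt
      one_ne_zero
  have hcomp : DifferentiableWithinAt ℝ
      (dz (inChart e' f) ∘ halfPlaneModel.extendCoordChange e e') ℍ₀ z := by
    have h1 := (hτ.hasFDerivWithinAt.restrictScalars ℝ).differentiableWithinAt.mono
      (Set.inter_subset_left (t := halfPlaneModel.extendCoordChange e e' ⁻¹' ℍ₀))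
    exact (hdz.comp z h1 (fun _ h => h.2)).mono_of_mem_nhdsWithin
      (Filter.inter_mem self_mem_nhdsWithin hmaps)
  -- The factor `τ'` is holomorphic, so its `z̄`-derivative vanishes and no first order term
  -- appears.
  rw [dzbar_congr hev hzH, dzbar_smul (hd.restrictScalars ℝ) hcomp hzH,
    dzbar_of_hasDerivWithinAt hd.hasDerivWithinAt hzH, zero_smul, zero_add,
    (dz_comp hτ hmaps hdz hzH).2, smul_smul]

end Scalar

section Operators

variable {V : Type*} [NormedAddCommGroup V] [InnerProductSpace ℂ V] [CompleteSpace V]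
  {P h : M → V →L[ℂ] V} {α β : ℝ≥0}

/-- Each term contains exactly one `z`- and one `z̄`-derivative in total, hence picks up the common
factor `τ' · conj τ' = |τ'|²`. -/
theorem localL_coordChange (hP : IsHolderClass 2 α P) (hh : IsHolderClass 2 β h)
    (he : e ∈ atlas ClosedHalfPlane M) (he' : e' ∈ atlas ClosedHalfPlane M)
    (hz : z ∈ (halfPlaneModel.extendCoordChange e e').source) :
    localL e P h z =
      ((‖derivWithin (halfPlaneModel.extendCoordChange e e') ℍ₀ z‖ ^ 2 : ℝ) : ℂ) •
        localL e' P h (halfPlaneModel.extendCoordChange e e' z) := by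
  have hnorm : ((‖derivWithin (halfPlaneModel.extendCoordChange e e') ℍ₀ z‖ ^ 2 : ℝ) : ℂ) =
      derivWithin (halfPlaneModel.extendCoordChange e e') ℍ₀ z *
        starRingEnd ℂ (derivWithin (halfPlaneModel.extendCoordChange e e') ℍ₀ z) := by
    rw [Complex.mul_conj, Complex.normSq_eq_norm_sq]
  rw [hnorm, localL, localL, dzbar_dz_inChart_coordChange hh he he' hz,
    (dz_inChart_coordChange hh he he' hz).1, (dz_inChart_coordChange hh he he' hz).2,
    (dz_inChart_coordChange hP he he' hz).1, (dz_inChart_coordChange hP he he' hz).2,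
    inChart_eq_comp_coordChange P hz, inChart_eq_comp_coordChange h hz]
  simp only [Function.comp_apply, smul_mul_assoc, mul_smul_comm, smul_smul, smul_add, smul_sub]

/-- The factor `|τ'|²` of the local expression cancels that of the coefficient `g`. This is what
makes `opL` continuous although it is defined with a chart varying from point to point. -/
theorem opL_eq (Ω : PositiveForm M) (hP : IsHolderClass 2 α P) (hh : IsHolderClass 2 β h)
    (he : e ∈ atlas ClosedHalfPlane M) {x : M} (hx : x ∈ e.source) :
    opL Ω P h x = ((1 / Ω.coeff e (e.extend halfPlaneModel x) : ℝ) : ℂ) •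
      localL e P h (e.extend halfPlaneModel x) := by
  set e₀ := chartAt ClosedHalfPlane x with he₀
  have hxe₀ : x ∈ e₀.source := mem_chart_source ClosedHalfPlane x
  have h₀ : e₀ ∈ atlas ClosedHalfPlane M := chart_mem_atlas ClosedHalfPlane x
  have hinv : (e₀.extend halfPlaneModel).symm (e₀.extend halfPlaneModel x) = x :=
    e₀.extend_left_inv hxe₀
  have hz : e₀.extend halfPlaneModel x ∈ (halfPlaneModel.extendCoordChange e₀ e).source := by
    rw [← OpenPartialHomeomorph.extend_image_source_inter]
    exact Set.mem_image_of_mem _ ⟨hxe₀, hx⟩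
  have hτ : halfPlaneModel.extendCoordChange e₀ e (e₀.extend halfPlaneModel x) =
      e.extend halfPlaneModel x := by
    change e.extend halfPlaneModel ((e₀.extend halfPlaneModel).symm _) = _
    rw [hinv]
  have hc := Ω.compatible e₀ h₀ e he _ hz
  have hpos := Ω.pos e₀ h₀ _ hz.1
  rw [hinv] at hc
  change Ω.coeff e₀ _ = ‖derivWithin (halfPlaneModel.extendCoordChange e₀ e) _ _‖ ^ 2 * _ at hc
  change ((1 / Ω.coeff e₀ (e₀.extend halfPlaneModel x) : ℝ) : ℂ) •
    localL e₀ P h (e₀.extend halfPlaneModel x) = _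
  rw [localL_coordChange hP hh h₀ he hz, hτ, smul_smul, ← Complex.ofReal_mul]
  congr 2
  rw [hc] at hpos ⊢
  set a := ‖derivWithin (halfPlaneModel.extendCoordChange e₀ e) ℍ₀ (e₀.extend halfPlaneModel x)‖
  have ha : a ≠ 0 := fun h0 => by
    rw [h0, zero_pow two_ne_zero, zero_mul] at hpos; exact lt_irrefl _ hpos
  have hb : Ω.coeff e (e.extend halfPlaneModel x) ≠ 0 := fun h0 => by
    rw [h0, mul_zero] at hpos; exact lt_irrefl _ hpos
  field_simp

omit [IsManifold halfPlaneModel ω M] in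
theorem continuousOn_localL (hP : IsHolderClass 2 α P) (hPu : ∀ x, IsUnit (P x))
    (hh : IsHolderClass 2 β h) (he : e ∈ atlas ClosedHalfPlane M) :
    ContinuousOn (localL e P h) (e.extend halfPlaneModel).target := by
  intro z hz
  have hzH := extend_target_subset_halfPlane hz
  have c1 : (1 : WithTop ℕ∞) + 1 ≤ 2 := by norm_num [one_add_one_eq_two]
  have cP := hP.contDiffWithinAt he hz
  have ch := hh.contDiffWithinAt he hz
  have hinv : ContinuousWithinAt (fun w => Ring.inverse (inChart e P w)) ℍ₀ z := by
    obtain ⟨u, hu⟩ := hPu ((e.extend halfPlaneModel).symm z)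
    have h1 := NormedRing.inverse_continuousAt u
    rw [hu] at h1
    exact ContinuousAt.comp_continuousWithinAt (f := inChart e P) h1 cP.continuousWithinAt
  have hPz := (cP.dz (m := 1) c1 hzH).continuousWithinAt
  have hPzb := (cP.dzbar (m := 1) c1 hzH).continuousWithinAt
  have hhz := (ch.dz (m := 1) c1 hzH).continuousWithinAt
  have hhzb := (ch.dzbar (m := 1) c1 hzH).continuousWithinAt
  have hhzz := ((ch.dz (m := 1) c1 hzH).dzbar (m := 0) (by norm_num) hzH).continuousWithinAt
  exact ((((hhzz.sub ((hPzb.mul hinv).mul hhz)).sub ((hhzb.mul hinv).mul hPz)).add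
    ((((hPzb.mul hinv).mul ch.continuousWithinAt).mul hinv).mul hPz))).mono
    extend_target_subset_halfPlane

theorem continuous_opL (Ω : PositiveForm M) (hP : IsHolderClass 2 α P) (hPu : ∀ x, IsUnit (P x))
    (hh : IsHolderClass 2 β h) : Continuous (opL Ω P h) := by
  refine continuous_iff_continuousAt.2 fun x => ?_
  set e := chartAt ClosedHalfPlane x with he₀
  have he : e ∈ atlas ClosedHalfPlane M := chart_mem_atlas ClosedHalfPlane x
  have hnhds : e.source ∈ 𝓝 x := e.open_source.mem_nhds (mem_chart_source ClosedHalfPlane x)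
  have h1 : ContinuousOn (fun z => ((1 / Ω.coeff e z : ℝ) : ℂ) • localL e P h z)
      (e.extend halfPlaneModel).target := by
    refine ContinuousOn.smul (Complex.continuous_ofReal.comp_continuousOn ?_)
      (continuousOn_localL hP hPu hh he)
    exact continuousOn_const.div (Ω.smooth e he).continuousOn fun z hz => (Ω.pos e he z hz).ne'
  refine ((ContinuousOn.comp_extend h1).continuousAt hnhds).congr ?_
  filter_upwards [hnhds] with y hy
  exact (opL_eq Ω hP hh he hy).symm

end Operators

end ChartChange

/-! ### Second differences and the mixed derivative -/

section SecondOrder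

variable {E : Type*} [NormedAddCommGroup E] [NormedSpace ℂ E] {f : ℂ → E} {z : ℂ}

/-- Symmetric second differences approximate the second derivative. -/
theorem norm_second_difference_le (hf : ContDiffAt ℝ 2 f z) (v : ℂ) {ε : ℝ} (hε : 0 < ε) :
    ∀ᶠ r : ℝ in 𝓝[>] 0, ‖f (z + r * v) + f (z - r * v) - (2 : ℝ) • f z
      - (r ^ 2) • fderiv ℝ (fderiv ℝ f) z v v‖ ≤ ε * r ^ 2 := by
  have hev : ∀ᶠ w in 𝓝 z, DifferentiableAt ℝ f w := by
    filter_upwards [hf.eventually (by simp)] with w hw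
    exact hw.differentiableAt (by simp)
  have hD : HasFDerivAt (fderiv ℝ f) (fderiv ℝ (fderiv ℝ f) z) z :=
    ((hf.fderiv_right (m := 1) (by norm_num [one_add_one_eq_two])).differentiableAt
      one_ne_zero).hasFDerivAt
  set D' := fderiv ℝ (fderiv ℝ f) z with hD'
  -- Two first order errors of size `ε' r ‖v‖²` must add up to at most `ε r`; the `+ 1` covers `v =
  -- 0`.
  set ε' := ε / (2 * (‖v‖ ^ 2 + 1)) with hε'
  have hε'pos : 0 < ε' := by positivity
  have hlo := hD.isLittleO.def hε'pos
  obtain ⟨ρ, hρ, hball⟩ := Metric.eventually_nhds_iff.1 (hev.and hlo)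
  have hρ' : 0 < ρ / (‖v‖ + 1) := by positivity
  filter_upwards [Ioo_mem_nhdsGT hρ'] with r hr
  have hin : ∀ t : ℝ, |t| ≤ r → dist (z + t * v) z < ρ := by
    intro t ht
    rw [dist_eq_norm, add_sub_cancel_left, norm_mul, Complex.norm_real, Real.norm_eq_abs]
    have h1 : r * (‖v‖ + 1) < ρ := (lt_div_iff₀ (by positivity)).1 hr.2
    nlinarith [norm_nonneg v, abs_nonneg t, hr.1]
  -- The mean value inequality is applied to `q` on `[0, r]`. Differentiability of `f'` at `z` alone
  -- bounds `q'` by `ε r`, hence `q r - q 0` by `ε r²`.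
  let q : ℝ → E := fun t => f (z + t * v) + f (z - t * v) - (t ^ 2) • D' v v
  let q' : ℝ → E := fun t =>
    fderiv ℝ f (z + t * v) v - fderiv ℝ f (z - t * v) v - (2 * t) • D' v v
  have hline : ∀ t : ℝ, HasDerivAt (fun t : ℝ => z + t * v) v t := fun t => by
    have := ((Complex.ofRealCLM.hasDerivAt (x := t)).mul_const v).const_add z
    simpa using this
  have hline' : ∀ t : ℝ, HasDerivAt (fun t : ℝ => z - t * v) (-v) t := fun t => by
    have := ((Complex.ofRealCLM.hasDerivAt (x := t)).mul_const v).const_sub z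
    simpa using this
  have hneg : ∀ t : ℝ, z - t * v = z + ((-t : ℝ) : ℂ) * v := fun t => by push_cast; ring
  have hq : ∀ t ∈ Set.Icc 0 r, HasDerivWithinAt q (q' t) (Set.Icc 0 r) t := by
    intro t ht
    have ht' : |t| ≤ r := by rw [abs_of_nonneg ht.1]; exact ht.2
    have h1 := (hball (hin t ht')).1.hasFDerivAt.comp_hasDerivAt t (hline t)
    have h2' := (hball (hin (-t) (by rwa [abs_neg]))).1
    rw [← hneg] at h2'
    have h2 := h2'.hasFDerivAt.comp_hasDerivAt t (hline' t)
    have h3 : HasDerivAt (fun t : ℝ => (t ^ 2) • D' v v) ((2 * t) • D' v v) t := by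
      simpa using (hasDerivAt_pow 2 t).smul_const (D' v v)
    refine ((h1.add h2).sub h3).hasDerivWithinAt.congr_deriv ?_
    simp [q', sub_eq_add_neg]
  have hbd : ∀ t ∈ Set.Icc 0 r, ‖q' t‖ ≤ ε * r := by
    intro t ht
    have ht' : |t| ≤ r := by rw [abs_of_nonneg ht.1]; exact ht.2
    have key : ∀ s : ℝ, |s| ≤ r →
        ‖fderiv ℝ f (z + s * v) v - fderiv ℝ f z v - s • D' v v‖ ≤ ε' * (r * ‖v‖) * ‖v‖ := by
      intro s hs
      have h1 := (hball (hin s hs)).2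
      rw [add_sub_cancel_left] at h1
      have h2 : D' ((s : ℂ) * v) = s • D' v := by
        rw [← map_smul, Complex.real_smul]
      rw [h2] at h1
      have h3 := ContinuousLinearMap.le_opNorm
        (fderiv ℝ f (z + s * v) - fderiv ℝ f z - s • D' v) v
      simp only [_root_.sub_apply, _root_.smul_apply] at h3
      refine h3.trans (mul_le_mul_of_nonneg_right (h1.trans ?_) (norm_nonneg v))
      rw [norm_mul, Complex.norm_real, Real.norm_eq_abs]
      gcongr
    have k1 := key t ht'
    have k2 := key (-t) (by rwa [abs_neg])
    rw [← hneg] at k2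
    have hsplit : q' t = (fderiv ℝ f (z + t * v) v - fderiv ℝ f z v - t • D' v v) -
        (fderiv ℝ f (z - t * v) v - fderiv ℝ f z v - (-t) • D' v v) := by
      simp only [q']
      module
    rw [hsplit]
    refine (norm_sub_le _ _).trans ((add_le_add k1 k2).trans ?_)
    have : ε = ε' * (2 * (‖v‖ ^ 2 + 1)) := by rw [hε']; field_simp
    rw [this]
    nlinarith [hr.1, mul_pos hε'pos hr.1]
  have hmv := (convex_Icc 0 r).norm_image_sub_le_of_norm_hasDerivWithin_le hq hbd
    (Set.left_mem_Icc.2 hr.1.le) (Set.right_mem_Icc.2 hr.1.le)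
  have e1 : q r - q 0 = f (z + r * v) + f (z - r * v) - (2 : ℝ) • f z - (r ^ 2) • D' v v := by
    simp only [q, Complex.ofReal_zero, zero_mul, add_zero, sub_zero, ne_eq, OfNat.ofNat_ne_zero,
      not_false_eq_true, zero_pow, zero_smul]
    module
  rw [e1, sub_zero, Real.norm_eq_abs, abs_of_pos hr.1] at hmv
  linarith [hmv, show ε * r * r = ε * r ^ 2 by ring]

/-- The mixed terms in `f_{xy}` cancel by symmetry of the second derivative, leaving a quarter of
the Laplacian. -/
theorem dzbar_dz_eq (hf : ContDiffAt ℝ 2 f z) (hz : 0 < z.im) :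
    dzbar (dz f) z = (1 / 4 : ℂ) • (fderiv ℝ (fderiv ℝ f) z 1 1 +
      fderiv ℝ (fderiv ℝ f) z Complex.I Complex.I) := by
  have hsymm := (hf.isSymmSndFDerivAt (by simp)) 1 Complex.I
  have hD : HasFDerivAt (fderiv ℝ f) (fderiv ℝ (fderiv ℝ f) z) z :=
    ((hf.fderiv_right (m := 1) (by norm_num [one_add_one_eq_two])).differentiableAt
      one_ne_zero).hasFDerivAt
  set D' := fderiv ℝ (fderiv ℝ f) z with hD'
  have hev : dz f =ᶠ[𝓝 z] fun w =>
      (1 / 2 : ℂ) • (fderiv ℝ f w 1 - Complex.I • fderiv ℝ f w Complex.I) := by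
    filter_upwards [(isOpen_lt continuous_const Complex.continuous_im).mem_nhds
      (show z ∈ {w : ℂ | 0 < w.im} from hz)] with w hw
    rw [dz, fderivWithin_of_mem_nhds (halfPlane_mem_nhds hw)]
  rw [dzbar_congr (hev.filter_mono nhdsWithin_le_nhds) hz.le]
  have hd := (((hD.clm_apply (hasFDerivAt_const (1 : ℂ) z)).sub
    ((hD.clm_apply (hasFDerivAt_const Complex.I z)).const_smul Complex.I)).const_smul
      (1 / 2 : ℂ)).hasFDerivWithinAt (s := ℍ₀)
  refine (hd.dzbar_eq hz.le).trans ?_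
  simp only [_root_.smul_apply, _root_.sub_apply, _root_.add_apply, ContinuousLinearMap.comp_apply,
    ContinuousLinearMap.flip_apply, _root_.zero_apply, map_zero, zero_add, hsymm]
  match_scalars <;> ring_nf <;> (simp only [Complex.I_sq]; ring_nf)

/-- For operator-valued `f` the error is an operator norm, so the same `r` serves all unit vectors
at once. -/
theorem norm_four_point_le (hf : ContDiffAt ℝ 2 f z) (hz : 0 < z.im) {ε : ℝ} (hε : 0 < ε) :
    ∀ᶠ r : ℝ in 𝓝[>] 0, ‖f (z + r) + f (z - r) + (f (z + r * Complex.I) + f (z - r * Complex.I))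
      - (4 : ℝ) • f z - (4 * r ^ 2) • dzbar (dz f) z‖ ≤ ε * r ^ 2 := by
  filter_upwards [norm_second_difference_le hf 1 (half_pos hε),
    norm_second_difference_le hf Complex.I (half_pos hε)] with r h1 h2
  rw [mul_one] at h1
  rw [dzbar_dz_eq hf hz]
  set D' := fderiv ℝ (fderiv ℝ f) z with hD'
  have key : ∀ v : E, (4 * r ^ 2) • ((1 / 4 : ℂ) • v) = (r ^ 2) • v := fun v => by
    rw [← Complex.coe_smul (4 * r ^ 2), ← Complex.coe_smul (r ^ 2), smul_smul]
    congr 1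
    push_cast
    ring
  rw [key]
  refine le_trans (le_of_eq ?_) ((norm_add_le_of_le h1 h2).trans (le_of_eq (by ring)))
  congr 1
  module

end SecondOrder

/-! ### Conjugation by a first order parallel frame -/

section Conjugation

variable {A : Type*} [NormedRing A] [NormedAlgebra ℂ A] {z : ℂ}

theorem ContDiffWithinAt.eventually_differentiable {E : Type*} [NormedAddCommGroup E]
    [NormedSpace ℂ E] {f : ℂ → E} (hf : ContDiffWithinAt ℝ 2 f ℍ₀ z) (hz : z ∈ ℍ₀) :
    ∀ᶠ w in 𝓝[ℍ₀] z, DifferentiableWithinAt ℝ f ℍ₀ w := by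
  have h := hf.eventually (by simp)
  rw [Set.insert_eq_of_mem hz] at h
  filter_upwards [h] with w hw
  exact hw.differentiableWithinAt (by simp)

/-- The left factor is antiholomorphic and the right one holomorphic, both equal to `1` at `z`. Each
therefore contributes only through one first derivative, `-b` and `-a` respectively; with `b = P_z̄
P⁻¹` and `a = P⁻¹ P_z` the result is the twisted operator. -/
theorem dzbar_dz_conjugate {K : ℂ → A} (hK : ContDiffWithinAt ℝ 2 K ℍ₀ z) (hz : z ∈ ℍ₀) (a b : A) :
    dzbar (dz fun w => (1 - starRingEnd ℂ (w - z) • b) * K w * (1 - (w - z) • a)) z =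
      dzbar (dz K) z - b * dz K z - dzbar K z * a + b * K z * a := by
  have hR : ∀ w, HasDerivAt (fun w : ℂ => 1 - (w - z) • a) (-a) w := fun w => by
    simpa using (((hasDerivAt_id w).sub_const z).smul_const a).const_sub 1
  have hLF : ∀ w, HasFDerivAt (fun w : ℂ => 1 - starRingEnd ℂ (w - z) • b)
      (-((Complex.conjCLE : ℂ →L[ℝ] ℂ).smulRight b)) w := fun w => by
    have h1 : HasFDerivAt (fun w : ℂ => starRingEnd ℂ (w - z)) (Complex.conjCLE : ℂ →L[ℝ] ℂ) w :=
      (Complex.conjCLE : ℂ →L[ℝ] ℂ).hasFDerivAt.comp w ((hasFDerivAt_id w).sub_const z)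
    exact (h1.smul_const b).const_sub 1
  have hRd : ∀ w, DifferentiableWithinAt ℝ (fun w : ℂ => 1 - (w - z) • a) ℍ₀ w := fun w =>
    ((hR w).hasFDerivAt.restrictScalars ℝ).differentiableAt.differentiableWithinAt
  have hLd : ∀ w, DifferentiableWithinAt ℝ (fun w : ℂ => 1 - starRingEnd ℂ (w - z) • b) ℍ₀ w :=
    fun w => (hLF w).differentiableAt.differentiableWithinAt
  have hLz : ∀ w ∈ ℍ₀, dz (fun w : ℂ => 1 - starRingEnd ℂ (w - z) • b) w = 0 := fun w hw => by
    rw [(hLF w).hasFDerivWithinAt.dz_eq hw]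
    simp [smul_smul]
  have hLzb : ∀ w ∈ ℍ₀, dzbar (fun w : ℂ => 1 - starRingEnd ℂ (w - z) • b) w = -b := fun w hw => by
    rw [(hLF w).hasFDerivWithinAt.dzbar_eq hw]
    simp only [_root_.neg_apply, ContinuousLinearMap.smulRight_apply,
      ContinuousLinearEquiv.coe_coe, Complex.conjCLE_apply, map_one, Complex.conj_I, one_smul,
      neg_smul, neg_neg, smul_smul, Complex.I_mul_I]
    module
  have hKd := hK.eventually_differentiable hz
  have hev : (dz fun w => (1 - starRingEnd ℂ (w - z) • b) * K w * (1 - (w - z) • a)) =ᶠ[𝓝[ℍ₀] z]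
      fun w => (1 - starRingEnd ℂ (w - z) • b) * dz K w * (1 - (w - z) • a) +
        (1 - starRingEnd ℂ (w - z) • b) * K w * (-a) := by
    filter_upwards [hKd, self_mem_nhdsWithin] with w hw hwH
    rw [dz_mul ((hLd w).fun_mul hw) (hRd w) hwH, dz_mul (hLd w) hw hwH, hLz w hwH, zero_mul,
      zero_add,
      dz_of_hasDerivWithinAt (hR w).hasDerivWithinAt hwH]
  have hdzK : DifferentiableWithinAt ℝ (dz K) ℍ₀ z :=
    (hK.dz (m := 1) (by norm_num [one_add_one_eq_two]) hz).differentiableWithinAt one_ne_zero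
  have hc : DifferentiableWithinAt ℝ (fun _ : ℂ => -a) ℍ₀ z := differentiableWithinAt_const _
  have hcz : dzbar (fun _ : ℂ => -a) z = 0 :=
    dzbar_of_hasDerivWithinAt (hasDerivWithinAt_const z _ (-a)) hz
  have hKz := hK.differentiableWithinAt (by simp)
  rw [dzbar_congr hev hz, dzbar_add (((hLd z).fun_mul hdzK).fun_mul (hRd z))
      (((hLd z).fun_mul hKz).fun_mul hc) hz,
    dzbar_mul ((hLd z).fun_mul hdzK) (hRd z) hz, dzbar_mul (hLd z) hdzK hz,
    dzbar_mul ((hLd z).fun_mul hKz) hc hz, dzbar_mul (hLd z) hKz hz, hLzb z hz, hcz,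
    dzbar_of_hasDerivWithinAt (hR z).hasDerivWithinAt hz]
  simp only [sub_self, map_zero, zero_smul, sub_zero, one_mul, mul_one, mul_zero, add_zero]
  noncomm_ring

theorem dzbar_dz_sub_smul {h P : ℂ → A} {Φ : ℂ → ℂ} (ch : ContDiffWithinAt ℝ 2 h ℍ₀ z)
    (cP : ContDiffWithinAt ℝ 2 P ℍ₀ z) (cΦ : ContDiffWithinAt ℝ 2 Φ ℍ₀ z) (hz : z ∈ ℍ₀) :
    dz (fun w => h w - Φ w • P w) z = dz h z - (dz Φ z • P z + Φ z • dz P z) ∧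
    dzbar (fun w => h w - Φ w • P w) z = dzbar h z - (dzbar Φ z • P z + Φ z • dzbar P z) ∧
    dzbar (dz fun w => h w - Φ w • P w) z = dzbar (dz h) z -
      ((dzbar (dz Φ) z • P z + dz Φ z • dzbar P z) +
        (dzbar Φ z • dz P z + Φ z • dzbar (dz P) z)) := by
  have two : (1 : WithTop ℕ∞) + 1 ≤ 2 := by norm_num [one_add_one_eq_two]
  have first : ∀ w ∈ ℍ₀, DifferentiableWithinAt ℝ h ℍ₀ w → DifferentiableWithinAt ℝ P ℍ₀ w →
      DifferentiableWithinAt ℝ Φ ℍ₀ w →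
      dz (fun w => h w - Φ w • P w) w = dz h w - (dz Φ w • P w + Φ w • dz P w) :=
    fun w hw h1 h2 h3 => by rw [dz_sub h1 (h3.fun_smul h2) hw, dz_smul h3 h2 hw]
  have dh := ch.differentiableWithinAt (by simp)
  have dP := cP.differentiableWithinAt (by simp)
  have dΦ := cΦ.differentiableWithinAt (by simp)
  have dzh := (ch.dz (m := 1) two hz).differentiableWithinAt one_ne_zero
  have dzP := (cP.dz (m := 1) two hz).differentiableWithinAt one_ne_zero
  have dzΦ := (cΦ.dz (m := 1) two hz).differentiableWithinAt one_ne_zero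
  refine ⟨first z hz dh dP dΦ, ?_, ?_⟩
  · rw [dzbar_sub dh (dΦ.fun_smul dP) hz, dzbar_smul dΦ dP hz]
  · have hev : (dz fun w => h w - Φ w • P w) =ᶠ[𝓝[ℍ₀] z]
        fun w => dz h w - (dz Φ w • P w + Φ w • dz P w) := by
      filter_upwards [ch.eventually_differentiable hz, cP.eventually_differentiable hz,
        cΦ.eventually_differentiable hz, self_mem_nhdsWithin] with w h1 h2 h3 hw
      exact first w hw h1 h2 h3
    rw [dzbar_congr hev hz, dzbar_sub dzh ((dzΦ.fun_smul dP).fun_add (dΦ.fun_smul dzP)) hz,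
      dzbar_add (dzΦ.fun_smul dP) (dΦ.fun_smul dzP) hz, dzbar_smul dzΦ dP hz, dzbar_smul dΦ dzP hz]

/-- Conjugating `h - Φ P` by the first order parallel frame of a flat metric `P` turns the twisted
operator into `∂²/∂z∂z̄`. -/
theorem dzbar_dz_conjugate_flat {h P : ℂ → A} {Φ : ℂ → ℂ} (ch : ContDiffWithinAt ℝ 2 h ℍ₀ z)
    (cP : ContDiffWithinAt ℝ 2 P ℍ₀ z) (cΦ : ContDiffWithinAt ℝ 2 Φ ℍ₀ z) (hz : z ∈ ℍ₀)
    (hu : IsUnit (P z))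
    (hflat : dzbar (dz P) z = dzbar P z * Ring.inverse (P z) * dz P z) :
    dzbar (dz fun w => (1 - starRingEnd ℂ (w - z) • (dzbar P z * Ring.inverse (P z))) *
        (h w - Φ w • P w) * (1 - (w - z) • (Ring.inverse (P z) * dz P z))) z =
      (dzbar (dz h) z - dzbar P z * Ring.inverse (P z) * dz h z
        - dzbar h z * Ring.inverse (P z) * dz P z
        + dzbar P z * Ring.inverse (P z) * h z * Ring.inverse (P z) * dz P z)
      - dzbar (dz Φ) z • P z := by
  rw [dzbar_dz_conjugate (K := fun w => h w - Φ w • P w) (ch.sub (cΦ.smul cP)) hz]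
  obtain ⟨e1, e2, e3⟩ := dzbar_dz_sub_smul ch cP cΦ hz
  rw [e1, e2, e3, hflat]
  have i1 : Ring.inverse (P z) * P z = 1 := Ring.inverse_mul_cancel _ hu
  have i2 : P z * Ring.inverse (P z) = 1 := Ring.mul_inverse_cancel _ hu
  have j2 : ∀ x : A, P z * (Ring.inverse (P z) * x) = x := fun x => by
    rw [← mul_assoc, i2, one_mul]
  -- The frame makes `P` stationary: `P_z - P a = 0` and `P_z̄ - b P = 0` remove the first
  -- derivatives of `Φ`, and flatness removes the term in `Φ` itself.
  simp only [mul_sub, sub_mul, mul_add, add_mul, smul_mul_assoc, mul_smul_comm, mul_assoc, i1,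
    j2, mul_one]
  abel

end Conjugation

/-! ### Test functions -/

section TestFunction

/-- The mixed second derivative of `Re F - |f|²` with `F`, `f` holomorphic. -/
theorem dzbar_dz_test {F f : ℂ → ℂ} {z : ℂ} (hF : AnalyticAt ℂ F z) (hf : AnalyticAt ℂ f z)
    (hz : z ∈ ℍ₀) :
    ContDiffAt ℝ 2 (fun w => (((F w).re - ‖f w‖ ^ 2 : ℝ) : ℂ)) z ∧
    dzbar (dz fun w => (((F w).re - ‖f w‖ ^ 2 : ℝ) : ℂ)) z = -((‖deriv f z‖ ^ 2 : ℝ) : ℂ) := by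
  have cc : ∀ {g : ℂ → ℂ}, AnalyticAt ℂ g z → ContDiffAt ℝ 2 g z := fun h =>
    h.contDiffAt.restrict_scalars ℝ
  have cconj : ∀ {g : ℂ → ℂ}, AnalyticAt ℂ g z →
      ContDiffAt ℝ 2 (fun w => starRingEnd ℂ (g w)) z := fun h =>
    (Complex.conjCLE : ℂ →L[ℝ] ℂ).contDiff.contDiffAt.comp z (cc h)
  have hexp : (fun w => (((F w).re - ‖f w‖ ^ 2 : ℝ) : ℂ)) = fun w =>
      ((1 / 2 : ℂ) * F w + (1 / 2 : ℂ) * starRingEnd ℂ (F w)) - f w * starRingEnd ℂ (f w) := by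
    funext w
    rw [Complex.mul_conj, Complex.normSq_eq_norm_sq]
    push_cast
    rw [Complex.re_eq_add_conj]
    ring
  rw [hexp]
  refine ⟨((contDiffAt_const.mul (cc hF)).add (contDiffAt_const.mul (cconj hF))).sub
    ((cc hf).mul (cconj hf)), ?_⟩
  have hdiff : ∀ {g : ℂ → ℂ} {w}, AnalyticAt ℂ g w → DifferentiableWithinAt ℝ g ℍ₀ w := fun h =>
    (h.differentiableAt.restrictScalars ℝ).differentiableWithinAt
  have hdconj : ∀ {g : ℂ → ℂ} {w}, AnalyticAt ℂ g w →
      DifferentiableWithinAt ℝ (fun w => starRingEnd ℂ (g w)) ℍ₀ w := fun {g w} h =>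
    ((Complex.conjCLE : ℂ →L[ℝ] ℂ).differentiableAt.comp w
      (h.differentiableAt.restrictScalars ℝ)).differentiableWithinAt
  have hz1 : ∀ {g : ℂ → ℂ} {w}, AnalyticAt ℂ g w → w ∈ ℍ₀ → dz g w = deriv g w := fun h hw =>
    dz_of_hasDerivWithinAt h.differentiableAt.hasDerivAt.hasDerivWithinAt hw
  have hz2 : ∀ {g : ℂ → ℂ} {w}, AnalyticAt ℂ g w → w ∈ ℍ₀ → dzbar g w = 0 := fun h hw =>
    dzbar_of_hasDerivWithinAt h.differentiableAt.hasDerivAt.hasDerivWithinAt hw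
  have hσ : ∀ (c : ℂ) v, (Complex.conjCLE : ℂ →L[ℝ] ℂ) (c • v) =
      (starRingEnd ℂ c) • (Complex.conjCLE : ℂ →L[ℝ] ℂ) v := fun c v => by simp
  have hz3 : ∀ {g : ℂ → ℂ} {w}, AnalyticAt ℂ g w → w ∈ ℍ₀ →
      dz (fun w => starRingEnd ℂ (g w)) w = 0 := fun h hw => by
    refine (dz_conj_comp (Complex.conjCLE : ℂ →L[ℝ] ℂ) hσ (hdiff h) hw).trans ?_
    rw [hz2 h hw, map_zero]
  have hz4 : ∀ {g : ℂ → ℂ} {w}, AnalyticAt ℂ g w → w ∈ ℍ₀ →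
      dzbar (fun w => starRingEnd ℂ (g w)) w = starRingEnd ℂ (deriv g w) := fun h hw => by
    refine (dzbar_conj_comp (Complex.conjCLE : ℂ →L[ℝ] ℂ) hσ (hdiff h) hw).trans ?_
    rw [hz1 h hw]
    rfl
  have hc : ∀ {w}, AnalyticAt ℂ (fun _ : ℂ => (1 / 2 : ℂ)) w := analyticAt_const
  have hev : (dz fun w => ((1 / 2 : ℂ) * F w + (1 / 2 : ℂ) * starRingEnd ℂ (F w)) -
      f w * starRingEnd ℂ (f w)) =ᶠ[𝓝[ℍ₀] z]
      fun w => (1 / 2 : ℂ) * deriv F w - deriv f w * starRingEnd ℂ (f w) := by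
    filter_upwards [hF.eventually_analyticAt.filter_mono nhdsWithin_le_nhds,
      hf.eventually_analyticAt.filter_mono nhdsWithin_le_nhds, self_mem_nhdsWithin] with w h1 h2 hw
    have hcF : dz (fun w => (1 / 2 : ℂ) * F w) w = (1 / 2 : ℂ) * deriv F w := by
      rw [dz_mul (hdiff hc) (hdiff h1) hw, hz1 h1 hw, hz1 hc hw]
      simp
    have hsum : (fun w => (1 / 2 : ℂ) * F w + (1 / 2 : ℂ) * starRingEnd ℂ (F w)) =
        fun w => (1 / 2 : ℂ) * F w - (-(1 / 2 : ℂ)) * starRingEnd ℂ (F w) := by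
      funext w; ring
    have hc' : AnalyticAt ℂ (fun _ : ℂ => -(1 / 2 : ℂ)) w := analyticAt_const
    rw [dz_sub (((hdiff hc).fun_mul (hdiff h1)).fun_add ((hdiff hc).fun_mul (hdconj h1)))
      ((hdiff h2).fun_mul (hdconj h2)) hw, hsum, dz_sub ((hdiff hc).fun_mul (hdiff h1))
      ((hdiff hc').fun_mul (hdconj h1)) hw, hcF, dz_mul (hdiff hc') (hdconj h1) hw, hz3 h1 hw,
      hz1 hc' hw, dz_mul (hdiff h2) (hdconj h2) hw, hz1 h2 hw, hz3 h2 hw]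
    simp
  rw [dzbar_congr hev hz, dzbar_sub ((hdiff hc).fun_mul (hdiff hF.deriv))
    ((hdiff hf.deriv).fun_mul (hdconj hf)) hz, dzbar_mul (hdiff hc) (hdiff hF.deriv) hz,
    dzbar_mul (hdiff hf.deriv) (hdconj hf) hz, hz2 hc hz, hz2 hF.deriv hz, hz2 hf.deriv hz,
    hz4 hf hz, zero_mul, mul_zero, zero_mul, zero_add, zero_add, zero_sub, Complex.mul_conj,
    Complex.normSq_eq_norm_sq]

end TestFunction

/-! ### Quadratic forms and the second order condition at a touching point -/

section QuadraticForm

variable {V : Type*} [NormedAddCommGroup V] [InnerProductSpace ℂ V]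

/-- The real quadratic form `v ↦ Re ⟨T v, v⟩` of an operator. -/
noncomputable def reForm (T : V →L[ℂ] V) (v : V) : ℝ := (inner ℂ (T v) v).re

theorem reForm_add (S T : V →L[ℂ] V) (v : V) : reForm (S + T) v = reForm S v + reForm T v := by
  simp [reForm]

theorem reForm_sub (S T : V →L[ℂ] V) (v : V) : reForm (S - T) v = reForm S v - reForm T v := by
  simp [reForm]

theorem reForm_neg (T : V →L[ℂ] V) (v : V) : reForm (-T) v = -reForm T v := by
  simp [reForm]

theorem reForm_real_smul (r : ℝ) (T : V →L[ℂ] V) (v : V) :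
    reForm ((r : ℂ) • T) v = r * reForm T v := by
  simp [reForm]

theorem reForm_smul_vec (T : V →L[ℂ] V) (c : ℂ) (v : V) :
    reForm T (c • v) = ‖c‖ ^ 2 * reForm T v := by
  rw [reForm, reForm, map_smul, inner_smul_left, inner_smul_right, ← mul_assoc, Complex.conj_mul',
    ← Complex.ofReal_pow, Complex.re_ofReal_mul]

theorem abs_reForm_le (T : V →L[ℂ] V) (v : V) : |reForm T v| ≤ ‖T‖ * ‖v‖ ^ 2 :=
  (Complex.abs_re_le_norm _).trans ((norm_inner_le_norm _ _).trans (by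
    rw [pow_two, ← mul_assoc]
    exact mul_le_mul_of_nonneg_right (T.le_opNorm v) (norm_nonneg v)))

theorem reForm_conjugate [CompleteSpace V] (S K : V →L[ℂ] V) (v : V) :
    reForm (star S * K * S) v = reForm K (S v) := by
  change (inner ℂ (ContinuousLinearMap.adjoint S (K (S v))) v).re = _
  rw [ContinuousLinearMap.adjoint_inner_left, reForm]

/-- Coercivity of a positive invertible operator. -/
theorem ContinuousLinearMap.IsPositive.norm_sq_le {P : V →L[ℂ] V} (hP : P.IsPositive)
    (hu : IsUnit P) (v : V) : ‖v‖ ^ 2 ≤ ‖Ring.inverse P‖ * reForm P v := by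
  set T := Ring.inverse P with hT
  have hPT : ∀ x, P (T x) = x := fun x => by
    have h1 := Ring.mul_inverse_cancel P hu
    exact congrArg (fun S : V →L[ℂ] V => S x) h1
  rcases eq_or_ne v 0 with rfl | hv
  · simp [reForm]
  have hTpos : 0 < ‖T‖ := by
    rw [norm_pos_iff]
    intro h0
    apply hv
    rw [← hPT v, h0]
    simp
  -- Positivity of `P` at `v - t P⁻¹v`, with `t = 1/‖P⁻¹‖` minimising `-2t + t²‖P⁻¹‖`. This gives
  -- coercivity without square roots of operators.
  have hnn : 0 ≤ reForm P (v - ((1 / ‖T‖ : ℝ) : ℂ) • T v) := hP.2 _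
  have hsymm : inner ℂ (P v) (T v) = inner ℂ v v := by
    have := hP.1 v (T v)
    change inner ℂ (P v) (T v) = inner ℂ v (P (T v)) at this
    rw [this, hPT]
  have hb : (inner ℂ v (T v)).re ≤ ‖T‖ * ‖v‖ ^ 2 := by
    refine (Complex.re_le_norm _).trans ((norm_inner_le_norm _ _).trans ?_)
    nlinarith [T.le_opNorm v, norm_nonneg v]
  have hvv : (inner ℂ v v).re = ‖v‖ ^ 2 := by
    rw [inner_self_eq_norm_sq_to_K]
    norm_cast
  have hexp : reForm P (v - ((1 / ‖T‖ : ℝ) : ℂ) • T v) =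
      reForm P v - 2 * (1 / ‖T‖) * ‖v‖ ^ 2 + (1 / ‖T‖) ^ 2 * (inner ℂ v (T v)).re := by
    simp only [reForm, map_sub, map_smul, hPT, inner_sub_left, inner_sub_right, inner_smul_left,
      inner_smul_right, hsymm, Complex.conj_ofReal, Complex.sub_re, Complex.re_ofReal_mul, hvv]
    ring
  rw [hexp] at hnn
  have h2 : (1 / ‖T‖) ^ 2 * (inner ℂ v (T v)).re ≤ (1 / ‖T‖) ^ 2 * (‖T‖ * ‖v‖ ^ 2) := by gcongr
  have h3 : (1 / ‖T‖) ^ 2 * (‖T‖ * ‖v‖ ^ 2) = (1 / ‖T‖) * ‖v‖ ^ 2 := by field_simp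
  have h4 : (1 / ‖T‖) * ‖v‖ ^ 2 ≤ reForm P v := by linarith
  calc ‖v‖ ^ 2 = ‖T‖ * ((1 / ‖T‖) * ‖v‖ ^ 2) := by field_simp
    _ ≤ _ := by gcongr

/-- The second order condition at a point where the form `h` touches `(Re F - |f|²) P` from below,
for a flat metric `P`. -/
theorem norm_deriv_sq_le_of_touching [CompleteSpace V] {P h : ℂ → V →L[ℂ] V} {z : ℂ}
    {F f : ℂ → ℂ} {c : ℝ}
    (hz : 0 < z.im) (cP : ContDiffWithinAt ℝ 2 P ℍ₀ z) (ch : ContDiffWithinAt ℝ 2 h ℍ₀ z)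
    (hsa : ∀ᶠ w in 𝓝[ℍ₀] z, IsSelfAdjoint (P w)) (hpos : (P z).IsPositive) (hu : IsUnit (P z))
    (hflat : dzbar (dz P) z = dzbar P z * Ring.inverse (P z) * dz P z)
    (hF : AnalyticAt ℂ F z) (hf : AnalyticAt ℂ f z)
    (hL : ∀ v, -c * reForm (P z) v ≤
      reForm (dzbar (dz h) z - dzbar P z * Ring.inverse (P z) * dz h z
        - dzbar h z * Ring.inverse (P z) * dz P z
        + dzbar P z * Ring.inverse (P z) * h z * Ring.inverse (P z) * dz P z) v)
    (hle : ∀ᶠ w in 𝓝[ℍ₀] z, ∀ v, reForm (h w) v ≤ ((F w).re - ‖f w‖ ^ 2) * reForm (P w) v)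
    (htouch : ∀ δ > 0, ∃ v, ‖v‖ = 1 ∧
      -δ ≤ reForm (h z) v - ((F z).re - ‖f z‖ ^ 2) * reForm (P z) v) :
    ‖deriv f z‖ ^ 2 ≤ c := by
  by_contra! hlt
  obtain ⟨cΦ, eΦ⟩ := dzbar_dz_test hF hf hz.le
  set Φ : ℂ → ℂ := fun w => (((F w).re - ‖f w‖ ^ 2 : ℝ) : ℂ) with hΦ
  set a := Ring.inverse (P z) * dz P z with ha
  have hnhds : ℍ₀ ∈ 𝓝 z := halfPlane_mem_nhds hz
  have hnw : 𝓝[ℍ₀] z = 𝓝 z := nhdsWithin_eq_nhds.2 hnhds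
  -- Since `P` is self-adjoint, the two factors of the frame are adjoint to each other, so the
  -- conjugation has the form `S* K S` and preserves signs of quadratic forms.
  have hstar : star a = dzbar P z * Ring.inverse (P z) := by
    have hσ : ∀ (c : ℂ) (T : V →L[ℂ] V), ((starL' ℝ : (V →L[ℂ] V) ≃L[ℝ] (V →L[ℂ] V)) :
        (V →L[ℂ] V) →L[ℝ] (V →L[ℂ] V)) (c • T) = (starRingEnd ℂ c) •
        ((starL' ℝ : (V →L[ℂ] V) ≃L[ℝ] (V →L[ℂ] V)) : (V →L[ℂ] V) →L[ℝ] (V →L[ℂ] V)) T :=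
      fun c T => star_smul c T
    have h1 := dzbar_conj_comp ((starL' ℝ : (V →L[ℂ] V) ≃L[ℝ] (V →L[ℂ] V)) :
        (V →L[ℂ] V) →L[ℝ] (V →L[ℂ] V)) hσ (cP.differentiableWithinAt (by simp)) hz.le
    have h2 : dzbar P z = star (dz P z) := by
      refine Eq.trans (dzbar_congr ?_ hz.le) h1
      filter_upwards [hsa] with w hw
      exact hw.star_eq.symm
    rw [ha, star_mul, h2]
    congr 1
    have h3 : IsSelfAdjoint (P z) := hpos.isSelfAdjoint
    rw [← Ring.inverse_star, h3.star_eq]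
  have key := dzbar_dz_conjugate_flat ch cP (cΦ.contDiffWithinAt) hz.le hu hflat
  rw [eΦ, ← hstar, ← ha] at key
  set G : ℂ → V →L[ℂ] V := fun w => (1 - starRingEnd ℂ (w - z) • star a) *
    (h w - Φ w • P w) * (1 - (w - z) • a) with hG
  have cG : ContDiffAt ℝ 2 G z := by
    have k1 : ContDiffAt ℝ 2 (fun w : ℂ => (1 : V →L[ℂ] V) - (w - z) • a) z :=
      contDiffAt_const.sub ((contDiffAt_id.sub contDiffAt_const).smul contDiffAt_const)
    have k2 : ContDiffAt ℝ 2 (fun w : ℂ => (1 : V →L[ℂ] V) - starRingEnd ℂ (w - z) • star a) z :=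
      contDiffAt_const.sub (((Complex.conjCLE : ℂ →L[ℝ] ℂ).contDiff.contDiffAt.comp z
        (contDiffAt_id.sub contDiffAt_const)).smul contDiffAt_const)
    exact (k2.mul ((ch.contDiffAt hnhds).sub (cΦ.smul (cP.contDiffAt hnhds)))).mul k1
  have hGle : ∀ᶠ w in 𝓝 z, ∀ v, reForm (G w) v ≤ 0 := by
    rw [← hnw]
    filter_upwards [hle] with w hw v
    have e1 : 1 - starRingEnd ℂ (w - z) • star a = star (1 - (w - z) • a) := by
      rw [star_sub, star_one, star_smul]
      rfl
    simp only [hG]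
    rw [e1, reForm_conjugate, reForm_sub, hΦ, reForm_real_smul]
    exact sub_nonpos.2 (hw _)
  have hGz : ∀ v, reForm (G z) v = reForm (h z) v - ((F z).re - ‖f z‖ ^ 2) * reForm (P z) v := by
    intro v
    simp only [hG, sub_self, map_zero, zero_smul, sub_zero, one_mul, mul_one]
    rw [reForm_sub, hΦ, reForm_real_smul]
  set η := ‖deriv f z‖ ^ 2 - c with hη
  have hηpos : 0 < η := sub_pos.2 hlt
  -- The mixed derivative of `G` is `ℒh + |f'|² P`, and `ℒh ≥ -c P` by assumption.
  have hGzz : ∀ v, η * reForm (P z) v ≤ reForm (dzbar (dz G) z) v := by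
    intro v
    rw [key, reForm_sub, ← Complex.ofReal_neg, reForm_real_smul]
    have := hL v
    rw [← hstar] at this
    rw [hη]
    linarith
  set m := 1 / (‖Ring.inverse (P z)‖ + 1) with hm
  have hmpos : 0 < m := by positivity
  have hcoer : ∀ v, ‖v‖ = 1 → m ≤ reForm (P z) v := by
    intro v hv
    have h1 := hpos.norm_sq_le hu v
    rw [hv, one_pow] at h1
    have h2 : 0 ≤ reForm (P z) v := hpos.2 v
    rw [hm, div_le_iff₀ (by positivity)]
    nlinarith
  have hε : 0 < 2 * η * m := by positivity
  have hline : ∀ u : ℂ, ∀ᶠ r : ℝ in 𝓝[>] 0, ∀ v, reForm (G (z + r * u)) v ≤ 0 := by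
    intro u
    have ht : Filter.Tendsto (fun r : ℝ => z + r * u) (𝓝[>] 0) (𝓝 z) := by
      have : Continuous fun r : ℝ => z + r * u := by fun_prop
      have h0 := this.tendsto 0
      simp only [Complex.ofReal_zero, zero_mul, add_zero] at h0
      exact h0.mono_left nhdsWithin_le_nhds
    exact ht.eventually hGle
  -- The radius is fixed before the vector, which is possible because the difference estimate is
  -- uniform in `v`.
  obtain ⟨r, h4, l1, l2, l3, l4, hr⟩ := ((norm_four_point_le cG hz hε).and ((hline 1).and
    ((hline (-1)).and ((hline Complex.I).and ((hline (-Complex.I)).and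
      self_mem_nhdsWithin))))).exists
  have hr0 : 0 < r := hr
  -- With this defect, `-4 G(z)` contributes at most `r²ηm`, while `-4r² G_{z z̄}` contributes at
  -- most `-4r²ηm` and the four outer values are nonpositive. The total is at most `-3r²ηm`, against
  -- the lower bound `-2r²ηm` from `ε = 2ηm`.
  obtain ⟨v, hv, hvt⟩ := htouch (r ^ 2 * η * m / 4) (by positivity)
  rw [← hGz] at hvt
  simp only [mul_one, mul_neg, ← sub_eq_add_neg] at l1 l2 l3 l4
  have h5 := abs_reForm_le (G (z + r) + G (z - r) + (G (z + r * Complex.I) + G (z - r * Complex.I))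
      - (4 : ℝ) • G z - (4 * r ^ 2) • dzbar (dz G) z) v
  rw [hv, one_pow, mul_one, ← Complex.coe_smul, ← Complex.coe_smul, reForm_sub, reForm_sub,
    reForm_real_smul, reForm_real_smul, reForm_add, reForm_add, reForm_add] at h5
  have h6 := (abs_le.1 (h5.trans h4)).1
  have h7 := hGzz v
  have h8 : η * m ≤ reForm (dzbar (dz G) z) v :=
    (mul_le_mul_of_nonneg_left (hcoer v hv) hηpos.le).trans h7
  have h9 : r ^ 2 * (η * m) ≤ r ^ 2 * reForm (dzbar (dz G) z) v := by gcongr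
  have h10 : 0 < r ^ 2 * (η * m) := by positivity
  linarith [l1 v, l2 v, l3 v, l4 v]

end QuadraticForm

/-! ### Viscosity subsolutions and a uniform strict maximum principle -/

section Subsolution

variable {M : Type*} [TopologicalSpace M] [ChartedSpace ClosedHalfPlane M]

theorem mem_boundary_iff_im_eq_zero {x : M} :
    x ∈ halfPlaneModel.boundary M ↔ (extChartAt halfPlaneModel x x).im = 0 := by
  change extChartAt halfPlaneModel x x ∈ frontier (Set.range halfPlaneModel) ↔ _
  rw [range_halfPlaneModel, Complex.frontier_setOfPred_le_im]
  rfl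

theorem extChartAt_im_pos {x : M} (hx : x ∉ halfPlaneModel.boundary M) :
    0 < (extChartAt halfPlaneModel x x).im := by
  refine lt_of_le_of_ne ?_ fun h => hx (mem_boundary_iff_im_eq_zero.2 h.symm)
  exact extend_target_subset_halfPlane (mem_extChartAt_target (I := halfPlaneModel) x)

/-- `s ≤ 1` is a subsolution, in the viscosity sense, of `√-1 Λ ∂̄∂ s ≥ -κ` with boundary values at
most `0`; test functions have the form `Re F - |f|²` with `F`, `f` holomorphic. -/
structure IsSubsolution (Ω : PositiveForm M) (κ : ℝ) (s : M → ℝ) : Prop where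
  usc : UpperSemicontinuous s
  le_one : ∀ x, s x ≤ 1
  boundary : ∀ x ∈ halfPlaneModel.boundary M, s x ≤ 0
  touching : ∀ p ∉ halfPlaneModel.boundary M, ∀ F f : ℂ → ℂ,
    AnalyticAt ℂ F (extChartAt halfPlaneModel p p) →
    AnalyticAt ℂ f (extChartAt halfPlaneModel p p) →
    (∀ᶠ y in 𝓝 p, s y ≤ (F (extChartAt halfPlaneModel p y)).re
      - ‖f (extChartAt halfPlaneModel p y)‖ ^ 2) →
    s p = (F (extChartAt halfPlaneModel p p)).re - ‖f (extChartAt halfPlaneModel p p)‖ ^ 2 →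
    ‖deriv f (extChartAt halfPlaneModel p p)‖ ^ 2 ≤
      κ * Ω.coeff (chartAt ClosedHalfPlane p) (extChartAt halfPlaneModel p p)

variable {Ω : PositiveForm M}

theorem IsSubsolution.mono {κ κ' : ℝ} {s : M → ℝ} (hs : IsSubsolution Ω κ s) (h : κ ≤ κ') :
    IsSubsolution Ω κ' s where
  usc := hs.usc
  le_one := hs.le_one
  boundary := hs.boundary
  touching p hp F f hF hf hle heq := (hs.touching p hp F f hF hf hle heq).trans
    (mul_le_mul_of_nonneg_right h (Ω.pos _ (chart_mem_atlas ClosedHalfPlane p) _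
      (mem_extChartAt_target (I := halfPlaneModel) p)).le)

/-- Comparison of a subsolution with a strict supersolution in a chart. -/
theorem IsSubsolution.le_of_strict_supersolution [IsManifold halfPlaneModel ω M] {κ : ℝ} {s : M → ℝ}
    (hs : IsSubsolution Ω κ s) {e : OpenPartialHomeomorph M ClosedHalfPlane}
    (he : e ∈ atlas ClosedHalfPlane M) {A O : Set ℂ} (hA : IsCompact A)
    (hAt : A ⊆ (e.extend halfPlaneModel).target) (hO : IsOpen O) (hOA : O ∩ ℍ₀ ⊆ A) {F f : ℂ → ℂ}
    (hF : ∀ w ∈ A, AnalyticAt ℂ F w) (hf : ∀ w ∈ A, AnalyticAt ℂ f w)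
    (hstrict : ∀ w ∈ A, κ * Ω.coeff e w < ‖deriv f w‖ ^ 2)
    (hnn : ∀ w ∈ A, 0 ≤ (F w).re - ‖f w‖ ^ 2)
    (hbd : ∀ w ∈ A, w ∈ O ∨ s ((e.extend halfPlaneModel).symm w) ≤ (F w).re - ‖f w‖ ^ 2) :
    ∀ w ∈ A, s ((e.extend halfPlaneModel).symm w) ≤ (F w).re - ‖f w‖ ^ 2 := by
  by_contra! hcon
  obtain ⟨w₁, hw₁, hlt₁⟩ := hcon
  have husc : UpperSemicontinuousOn (fun w => s ((e.extend halfPlaneModel).symm w) +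
      -((F w).re - ‖f w‖ ^ 2)) A := by
    refine UpperSemicontinuousOn.add ?_ ?_
    · exact (hs.usc.upperSemicontinuousOn Set.univ).comp
        ((e.continuousOn_extend_symm (I := halfPlaneModel)).mono hAt) (fun _ _ => Set.mem_univ _)
    · refine ContinuousOn.upperSemicontinuousOn fun w hw => ?_
      exact ((Complex.continuous_re.continuousAt.comp (hF w hw).continuousAt).sub
        ((hf w hw).continuousAt.norm.pow 2)).neg.continuousWithinAt
  -- At a positive maximum `m` of `s - (Re F - |f|²)` the point is off the boundary of the surface
  -- and in `O`. The test function raised by `m` then touches `s` from above.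
  obtain ⟨w, hw, hmax⟩ := husc.exists_isMaxOn ⟨w₁, hw₁⟩ hA
  have hmax' : ∀ u ∈ A, s ((e.extend halfPlaneModel).symm u) + -((F u).re - ‖f u‖ ^ 2) ≤
      s ((e.extend halfPlaneModel).symm w) + -((F w).re - ‖f w‖ ^ 2) := fun u hu => hmax hu
  set m := s ((e.extend halfPlaneModel).symm w) + -((F w).re - ‖f w‖ ^ 2) with hm
  have hmpos : 0 < m := by linarith [hmax' w₁ hw₁]
  set p := (e.extend halfPlaneModel).symm w with hp
  have hpe : p ∈ e.source := by
    simpa only [OpenPartialHomeomorph.extend_source] using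
      (e.extend halfPlaneModel).map_target (hAt hw)
  have hew : e.extend halfPlaneModel p = w := (e.extend halfPlaneModel).right_inv (hAt hw)
  have hpb : p ∉ halfPlaneModel.boundary M := fun hb => by
    linarith [hs.boundary p hb, hnn w hw]
  have hwO : w ∈ O := (hbd w hw).resolve_right fun h => by linarith
  set e₀ := chartAt ClosedHalfPlane p with he₀
  have h₀ : e₀ ∈ atlas ClosedHalfPlane M := chart_mem_atlas ClosedHalfPlane p
  have hp₀ : p ∈ e₀.source := mem_chart_source ClosedHalfPlane p
  set z := extChartAt halfPlaneModel p p with hz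
  have hzim : 0 < z.im := extChartAt_im_pos hpb
  have hzs : z ∈ (halfPlaneModel.extendCoordChange e₀ e).source := by
    rw [← OpenPartialHomeomorph.extend_image_source_inter]
    exact Set.mem_image_of_mem _ ⟨hp₀, hpe⟩
  set τ : ℂ → ℂ := e.extend halfPlaneModel ∘ (e₀.extend halfPlaneModel).symm with hτdef
  have hτe : ∀ y ∈ e₀.source, τ (extChartAt halfPlaneModel p y) = e.extend halfPlaneModel y := by
    intro y hy
    change e.extend halfPlaneModel
      ((e₀.extend halfPlaneModel).symm (e₀.extend halfPlaneModel y)) = _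
    rw [e₀.extend_left_inv hy]
  have hτz : τ z = w := by rw [hz, hτe p hp₀, hew]
  have hnhds := halfPlane_mem_nhds hzim
  have hτc : ContDiffWithinAt ℂ ω τ ℍ₀ z := contDiffWithinAt_coordChange h₀ he hzs
  have hτan : AnalyticAt ℂ τ z := (hτc.contDiffAt hnhds).analyticAt
  have hcompat := Ω.compatible e₀ h₀ e he z hzs
  rw [← hτdef, derivWithin_of_mem_nhds hnhds] at hcompat
  change Ω.coeff e₀ z = ‖deriv τ z‖ ^ 2 * Ω.coeff e (τ z) at hcompat
  have hpos : 0 < Ω.coeff e₀ z := Ω.pos e₀ h₀ z hzs.1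
  rw [hτz] at hcompat
  have hτ' : 0 < ‖deriv τ z‖ ^ 2 := by
    refine lt_of_le_of_ne (by positivity) fun h => ?_
    rw [hcompat, ← h, zero_mul] at hpos
    exact lt_irrefl _ hpos
  have han : AnalyticAt ℂ (fun u => F (τ u) + (m : ℂ)) z :=
    ((hτz.symm ▸ hF w hw : AnalyticAt ℂ F (τ z)).comp hτan).add analyticAt_const
  have hfτ : AnalyticAt ℂ f (τ z) := hτz.symm ▸ hf w hw
  have hder : deriv (f ∘ τ) z = deriv f w * deriv τ z := by
    rw [deriv_comp z hfτ.differentiableAt hτan.differentiableAt, hτz]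
  -- The touching condition refers to the preferred chart at `p`; composing `F` and `f` with the
  -- holomorphic `τ` stays among test functions, and both sides of the inequality scale by `|τ'|²`.
  have ht := hs.touching p hpb (fun u => F (τ u) + (m : ℂ)) (f ∘ τ) han (hfτ.comp hτan) ?_ ?_
  · change ‖deriv (f ∘ τ) z‖ ^ 2 ≤ κ * Ω.coeff e₀ z at ht
    rw [hder, norm_mul, mul_pow, hcompat] at ht
    have h1 := mul_lt_mul_of_pos_right (hstrict w hw) hτ'
    linarith
  · have hopen := e.isOpen_extend_preimage (I := halfPlaneModel) hO
    filter_upwards [hopen.mem_nhds ⟨hpe, by change e.extend halfPlaneModel p ∈ O; rwa [hew]⟩,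
      e₀.open_source.mem_nhds hp₀] with y hy hy₀
    have hyt : e.extend halfPlaneModel y ∈ (e.extend halfPlaneModel).target :=
      (e.extend halfPlaneModel).map_source (by rw [OpenPartialHomeomorph.extend_source]; exact hy.1)
    have hyA : e.extend halfPlaneModel y ∈ A := hOA ⟨hy.2, extend_target_subset_halfPlane hyt⟩
    have h1 := hmax' _ hyA
    rw [e.extend_left_inv hy.1] at h1
    simp only [Function.comp_apply, hτe y hy₀, Complex.add_re, Complex.ofReal_re]
    linarith
  · simp only [Function.comp_apply, Complex.add_re, Complex.ofReal_re]
    rw [← hz, hτz]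
    linarith

/-- All subsolutions with a small constant stay uniformly below `1` on `U`. -/
def UniformlyBelow (Ω : PositiveForm M) (U : Set M) : Prop :=
  ∃ ε : ℝ, 0 < ε ∧ ε ≤ 1 ∧ ∃ κ : ℝ, 0 < κ ∧ ∀ s, IsSubsolution Ω κ s → ∀ y ∈ U, s y ≤ 1 - ε

theorem UniformlyBelow.union {U U' : Set M} (h : UniformlyBelow Ω U) (h' : UniformlyBelow Ω U') :
    UniformlyBelow Ω (U ∪ U') := by
  obtain ⟨ε, hε, hε1, κ, hκ, hs⟩ := h
  obtain ⟨ε', hε', _, κ', hκ', hs'⟩ := h'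
  refine ⟨min ε ε', lt_min hε hε', (min_le_left _ _).trans hε1, min κ κ', lt_min hκ hκ',
    fun s h y hy => ?_⟩
  rcases hy with hy | hy
  · linarith [hs s (h.mono (min_le_left _ _)) y hy, min_le_left ε ε']
  · linarith [hs' s (h.mono (min_le_right _ _)) y hy, min_le_right ε ε']

theorem PositiveForm.exists_bound (Ω : PositiveForm M)
    {e : OpenPartialHomeomorph M ClosedHalfPlane} (he : e ∈ atlas ClosedHalfPlane M) {A : Set ℂ}
    (hA : IsCompact A) (hAt : A ⊆ (e.extend halfPlaneModel).target) :
    ∃ B : ℝ, 0 < B ∧ ∀ w ∈ A, Ω.coeff e w ≤ B := by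
  obtain ⟨B, hB⟩ := hA.exists_bound_of_continuousOn ((Ω.smooth e he).continuousOn.mono hAt)
  refine ⟨|B| + 1, by positivity, fun w hw => ?_⟩
  linarith [hB w hw, le_abs_self B, Real.le_norm_self (Ω.coeff e w)]

variable [IsManifold halfPlaneModel ω M]

/-- In the rescaled coordinate `u = x + iy` centred at the point, the barrier is `x² - 3y² + 4y =
|u|² + 4y(1 - y)`. On the unit half-disc it is nonnegative, it is at least `1` on the arc, it
vanishes at the centre, and its mixed derivative is `-1`. -/
theorem exists_uniformlyBelow_of_mem_boundary (Ω : PositiveForm M) {x : M}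
    (hx : x ∈ halfPlaneModel.boundary M) : ∃ U ∈ 𝓝 x, UniformlyBelow Ω U := by
  set e := chartAt ClosedHalfPlane x with he₀
  have he : e ∈ atlas ClosedHalfPlane M := chart_mem_atlas ClosedHalfPlane x
  have hxe : x ∈ e.source := mem_chart_source ClosedHalfPlane x
  set z := e.extend halfPlaneModel x with hz
  have hzt : z ∈ (e.extend halfPlaneModel).target := mem_extChartAt_target (I := halfPlaneModel) x
  have hzim : z.im = 0 := mem_boundary_iff_im_eq_zero.1 hx
  obtain ⟨R, hR, hball⟩ := Metric.mem_nhdsWithin_iff.1 (extend_target_mem_nhdsWithin_halfPlane hzt)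
  set ρ := R / 2 with hρ
  have hρpos : 0 < ρ := half_pos hR
  set A := Metric.closedBall z ρ ∩ ℍ₀ with hAdef
  have hA : IsCompact A := (isCompact_closedBall z ρ).inter_right
    (isClosed_le continuous_const Complex.continuous_im)
  have hAt : A ⊆ (e.extend halfPlaneModel).target := fun w hw =>
    hball ⟨Metric.closedBall_subset_ball (by linarith) hw.1, hw.2⟩
  obtain ⟨B, hB, hbound⟩ := Ω.exists_bound he hA hAt
  let f : ℂ → ℂ := fun w => (w - z) / ρ
  let F : ℂ → ℂ := fun w => 2 * ((w - z) / ρ) ^ 2 - 4 * Complex.I * ((w - z) / ρ)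
  have hfan : ∀ w, AnalyticAt ℂ f w := fun w => by fun_prop (disch := simp [hρpos.ne'])
  have hFan : ∀ w, AnalyticAt ℂ F w := fun w => by fun_prop (disch := simp [hρpos.ne'])
  have hderiv : ∀ w, ‖deriv f w‖ ^ 2 = 1 / ρ ^ 2 := fun w => by
    have h1 : HasDerivAt f (1 / (ρ : ℂ)) w := ((hasDerivAt_id w).sub_const z).div_const _
    rw [h1.deriv, norm_div, norm_one, Complex.norm_real, Real.norm_eq_abs, abs_of_pos hρpos]
    ring
  have hval : ∀ w, (F w).re - ‖f w‖ ^ 2 =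
      ((w - z).re ^ 2 - 3 * w.im ^ 2) / ρ ^ 2 + 4 * (w.im / ρ) := fun w => by
    have e1 : ((w - z) / (ρ : ℂ)).re = (w - z).re / ρ := Complex.div_ofReal_re _ _
    have e2 : ((w - z) / (ρ : ℂ)).im = w.im / ρ := by
      rw [Complex.div_ofReal_im, Complex.sub_im, hzim, sub_zero]
    have e3 : ‖f w‖ ^ 2 = ((w - z).re / ρ) ^ 2 + (w.im / ρ) ^ 2 := by
      rw [← Complex.normSq_eq_norm_sq, Complex.normSq_apply, e1, e2]
      ring
    have e4 : (F w).re = 2 * (((w - z).re / ρ) ^ 2 - (w.im / ρ) ^ 2) + 4 * (w.im / ρ) := by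
      simp only [F, pow_two, Complex.sub_re, Complex.mul_re, Complex.mul_im, e1, e2,
        Complex.re_ofNat, Complex.im_ofNat, Complex.I_re, Complex.I_im]
      ring
    rw [e3, e4]
    ring
  have hnormsq : ∀ w, dist w z ^ 2 = (w - z).re ^ 2 + w.im ^ 2 := fun w => by
    rw [dist_eq_norm, ← Complex.normSq_eq_norm_sq, Complex.normSq_apply, Complex.sub_im, hzim,
      sub_zero]
    ring
  have him : ∀ w ∈ A, 0 ≤ w.im / ρ ∧ w.im / ρ ≤ 1 := fun w hw => by
    have h0 : 0 ≤ w.im := hw.2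
    refine ⟨div_nonneg h0 hρpos.le, (div_le_one hρpos).2 ?_⟩
    have h1 := Complex.abs_im_le_norm (w - z)
    rw [Complex.sub_im, hzim, sub_zero, abs_of_nonneg h0, ← dist_eq_norm] at h1
    exact h1.trans hw.1
  have hval' : ∀ w, (F w).re - ‖f w‖ ^ 2 =
      dist w z ^ 2 / ρ ^ 2 + 4 * (w.im / ρ) * (1 - w.im / ρ) := fun w => by
    rw [hval, hnormsq]
    ring
  have hcont : ContinuousAt (fun y => (F (e.extend halfPlaneModel y)).re -
      ‖f (e.extend halfPlaneModel y)‖ ^ 2) x := by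
    have h1 := OpenPartialHomeomorph.continuousAt_extend e (I := halfPlaneModel) hxe
    have h2 : ContinuousAt (fun w => (F w).re - ‖f w‖ ^ 2) z :=
      (Complex.continuous_re.continuousAt.comp (hFan z).continuousAt).sub
        ((hfan z).continuousAt.norm.pow 2)
    exact ContinuousAt.comp (f := e.extend halfPlaneModel) h2 h1
  have hx0 : (F (e.extend halfPlaneModel x)).re - ‖f (e.extend halfPlaneModel x)‖ ^ 2 < 1 / 2 := by
    rw [hval', ← hz, hzim]
    simp
  have hopen := e.isOpen_extend_preimage (I := halfPlaneModel)
    (Metric.isOpen_ball (x := z) (ε := ρ))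
  -- On the neighbourhood where the barrier is below `1/2`, so is `s`. The choice of `κ` gives `κ g
  -- ≤ 1/(2ρ²)`, strictly less than `|f'|² = 1/ρ²`.
  refine ⟨_, Filter.inter_mem (hopen.mem_nhds ⟨hxe, Metric.mem_ball_self hρpos⟩)
    (hcont.eventually_lt continuousAt_const hx0), 1 / 2, by norm_num, by norm_num,
    1 / (2 * ρ ^ 2 * B), by positivity, fun s hs y hy => ?_⟩
  have hyt : e.extend halfPlaneModel y ∈ (e.extend halfPlaneModel).target :=
    (e.extend halfPlaneModel).map_source (by rw [OpenPartialHomeomorph.extend_source]; exact hy.1.1)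
  have hyA : e.extend halfPlaneModel y ∈ A :=
    ⟨Metric.ball_subset_closedBall hy.1.2, extend_target_subset_halfPlane hyt⟩
  have hmain := hs.le_of_strict_supersolution he hA hAt Metric.isOpen_ball
    (Set.inter_subset_inter_left _ Metric.ball_subset_closedBall) (F := F) (f := f)
    (fun w _ => hFan w) (fun w _ => hfan w) ?_ ?_ ?_ _ hyA
  · rw [e.extend_left_inv hy.1.1] at hmain
    have : (F (e.extend halfPlaneModel y)).re - ‖f (e.extend halfPlaneModel y)‖ ^ 2 < 1 / 2 := hy.2
    linarith
  · intro w hw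
    rw [hderiv]
    calc 1 / (2 * ρ ^ 2 * B) * Ω.coeff e w ≤ 1 / (2 * ρ ^ 2 * B) * B := by
          gcongr; exact hbound w hw
      _ = 1 / ρ ^ 2 * (1 / 2) := by field_simp
      _ < 1 / ρ ^ 2 := mul_lt_of_lt_one_right (by positivity) (by norm_num)
  · intro w hw
    rw [hval']
    obtain ⟨h1, h2⟩ := him w hw
    have : 0 ≤ 4 * (w.im / ρ) * (1 - w.im / ρ) := mul_nonneg (by linarith) (by linarith)
    positivity
  · intro w hw
    rcases lt_or_eq_of_le (Metric.mem_closedBall.1 hw.1) with h | h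
    · exact Or.inl h
    · right
      rw [hval', h, div_self (by positivity)]
      obtain ⟨h1, h2⟩ := him w hw
      have : 0 ≤ 4 * (w.im / ρ) * (1 - w.im / ρ) := mul_nonneg (by linarith) (by linarith)
      linarith [hs.le_one ((e.extend halfPlaneModel).symm w)]

/-- A bound `1 - ε` near a point `q` spreads to a disc of controlled radius about `q`, which
contains `x` once `q` is close enough. The barrier on the annulus `r ≤ |w - q| ≤ 2R` is `1 + a/(4R²)
- a/|w - q|²`, equal to `1` on the outer circle. -/
theorem exists_uniformlyBelow_of_mem_closure (Ω : PositiveForm M) {x : M}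
    (hx : x ∉ halfPlaneModel.boundary M)
    (hcl : x ∈ closure {y : M | ∃ U ∈ 𝓝 y, UniformlyBelow Ω U}) :
    ∃ U ∈ 𝓝 x, UniformlyBelow Ω U := by
  set e := chartAt ClosedHalfPlane x with he₀
  have he : e ∈ atlas ClosedHalfPlane M := chart_mem_atlas ClosedHalfPlane x
  have hxe : x ∈ e.source := mem_chart_source ClosedHalfPlane x
  set z := e.extend halfPlaneModel x with hz
  have hzt : z ∈ (e.extend halfPlaneModel).target := mem_extChartAt_target (I := halfPlaneModel) x
  have hzim : 0 < z.im := extChartAt_im_pos hx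
  have htn : (e.extend halfPlaneModel).target ∈ 𝓝 z := by
    have h := extend_target_mem_nhdsWithin_halfPlane hzt
    rwa [nhdsWithin_eq_nhds.2 (halfPlane_mem_nhds hzim)] at h
  obtain ⟨R₀, hR₀, hball⟩ := Metric.mem_nhds_iff.1 htn
  -- A disc of radius `2R` about a point within `R` of `z` stays within `3R < R₀` of `z`, hence in
  -- the chart.
  set R := R₀ / 4 with hRdef
  have hR : 0 < R := by positivity
  clear_value R
  have hopenR := e.isOpen_extend_preimage (I := halfPlaneModel)
    (Metric.isOpen_ball (x := z) (ε := R))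
  obtain ⟨y, ⟨hye, hyR⟩, U, hU, ε, hε, hε1, κ₁, hκ₁, hUs⟩ := mem_closure_iff_nhds.1 hcl _
    (hopenR.mem_nhds ⟨hxe, Metric.mem_ball_self hR⟩)
  set q := e.extend halfPlaneModel y with hq
  have hyR' : dist q z < R := hyR
  have hqball : Metric.closedBall q (2 * R) ⊆ (e.extend halfPlaneModel).target := fun w hw => by
    refine hball (Metric.mem_ball.2 ?_)
    have := dist_triangle w q z
    have h2 := Metric.mem_closedBall.1 hw
    linarith
  have hUq : (e.extend halfPlaneModel).symm ⁻¹' U ∈ 𝓝 q := by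
    have h1 := e.continuousAt_extend_symm (I := halfPlaneModel) hye
    exact h1.preimage_mem_nhds (by rwa [e.extend_left_inv hye])
  obtain ⟨r₀, hr₀, hrU⟩ := Metric.mem_nhds_iff.1 hUq
  set r := min (r₀ / 2) R with hrdef
  have hr : 0 < r := lt_min (half_pos hr₀) hR
  have hrR : r ≤ R := min_le_right _ _
  have hrr₀ : r < r₀ := (min_le_left _ _).trans_lt (half_lt_self hr₀)
  set A := Metric.closedBall q (2 * R) \ Metric.ball q r with hAdef
  set O := Metric.ball q (2 * R) \ Metric.closedBall q r with hOdef
  have hA : IsCompact A := (isCompact_closedBall q _).diff Metric.isOpen_ball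
  have hAt : A ⊆ (e.extend halfPlaneModel).target := Set.sdiff_subset.trans hqball
  have hO : IsOpen O := Metric.isOpen_ball.sdiff Metric.isClosed_closedBall
  have hOA : O ∩ ℍ₀ ⊆ A := fun w hw =>
    ⟨Metric.ball_subset_closedBall hw.1.1, fun h => hw.1.2 (Metric.ball_subset_closedBall h)⟩
  obtain ⟨B, hB, hbound⟩ := Ω.exists_bound he hA hAt
  -- This makes the barrier equal to `1 - ε + a/(4R²)` on the inner circle, above the known bound
  -- for `s`. For `|w - q| < R` it is at most `1 - 3a/(4R²)`, which is the new gap.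
  set a := ε * r ^ 2 with ha
  have hapos : 0 < a := by positivity
  let f : ℂ → ℂ := fun w => (Real.sqrt a : ℂ) / (w - q)
  let F : ℂ → ℂ := fun _ => ((1 + a / (4 * R ^ 2) : ℝ) : ℂ)
  have hne : ∀ w ∈ A, w - q ≠ 0 := fun w hw h => hw.2 (by
    rw [sub_eq_zero.1 h]; exact Metric.mem_ball_self hr)
  have hdist : ∀ w ∈ A, r ≤ dist w q ∧ dist w q ≤ 2 * R := fun w hw =>
    ⟨not_lt.1 hw.2, hw.1⟩
  have hval : ∀ w, (F w).re - ‖f w‖ ^ 2 = 1 + a / (4 * R ^ 2) - a / dist w q ^ 2 := fun w => by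
    simp only [F, f]
    rw [Complex.ofReal_re, norm_div, div_pow, Complex.norm_real, Real.norm_eq_abs, sq_abs,
      Real.sq_sqrt hapos.le, dist_eq_norm]
  have hfan : ∀ w ∈ A, AnalyticAt ℂ f w := fun w hw =>
    analyticAt_const.div (analyticAt_id.sub analyticAt_const) (hne w hw)
  have hderiv : ∀ w ∈ A, ‖deriv f w‖ ^ 2 = a / dist w q ^ 4 := fun w hw => by
    have h1 : HasDerivAt f (-(Real.sqrt a : ℂ) / (w - q) ^ 2) w := by
      have h2 := (hasDerivAt_const w (Real.sqrt a : ℂ)).div ((hasDerivAt_id w).sub_const q)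
        (hne w hw)
      refine h2.congr_deriv ?_
      simp
    rw [h1.deriv, norm_div, norm_neg, norm_pow, div_pow, Complex.norm_real, Real.norm_eq_abs,
      sq_abs, Real.sq_sqrt hapos.le, dist_eq_norm, ← pow_mul]
  have hκpos : 0 < a / (32 * R ^ 4 * B) := by positivity
  have hεa : 3 * a / (4 * R ^ 2) ≤ ε := by
    rw [div_le_iff₀ (by positivity), ha]
    have : r ^ 2 ≤ R ^ 2 := by gcongr
    nlinarith [mul_le_mul_of_nonneg_left this hε.le]
  have hopen := e.isOpen_extend_preimage (I := halfPlaneModel)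
    (Metric.isOpen_ball (x := q) (ε := R))
  refine ⟨_, hopen.mem_nhds ⟨hxe, by rw [Set.mem_preimage, Metric.mem_ball']; exact hyR'⟩,
    3 * a / (4 * R ^ 2), by positivity, hεa.trans hε1, min κ₁ (a / (32 * R ^ 4 * B)),
    lt_min hκ₁ hκpos, fun s hs y' hy' => ?_⟩
  have hs₁ := hUs s (hs.mono (min_le_left _ _))
  have hsU : ∀ w, dist w q ≤ r → s ((e.extend halfPlaneModel).symm w) ≤ 1 - ε := fun w hw =>
    hs₁ _ (hrU (Metric.mem_ball.2 (hw.trans_lt hrr₀)))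
  have hdy' : dist (e.extend halfPlaneModel y') q < R := hy'.2
  rcases le_or_gt (dist (e.extend halfPlaneModel y') q) r with hcase | hcase
  · have h1 := hsU _ hcase
    rw [e.extend_left_inv hy'.1] at h1
    linarith
  have hyA : e.extend halfPlaneModel y' ∈ A :=
    ⟨Metric.mem_closedBall.2 (by linarith), fun h => lt_asymm hcase (Metric.mem_ball.1 h)⟩
  have hmain := (hs.mono (min_le_right _ _)).le_of_strict_supersolution he hA hAt hO hOA (F := F)
    (f := f) (fun w _ => analyticAt_const) hfan ?_ ?_ ?_ _ hyA
  · rw [e.extend_left_inv hy'.1, hval] at hmain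
    have h1 : a / R ^ 2 ≤ a / dist (e.extend halfPlaneModel y') q ^ 2 := by
      have : 0 < dist (e.extend halfPlaneModel y') q := hr.trans hcase
      gcongr
    have h2 : a / R ^ 2 - a / (4 * R ^ 2) = 3 * a / (4 * R ^ 2) := by field_simp; ring
    linarith
  · intro w hw
    obtain ⟨h1, h2⟩ := hdist w hw
    have h0 : 0 < dist w q := hr.trans_le h1
    rw [hderiv w hw]
    calc a / (32 * R ^ 4 * B) * Ω.coeff e w ≤ a / (32 * R ^ 4 * B) * B := by
          gcongr; exact hbound w hw
      _ = a / (2 * R) ^ 4 * (1 / 2) := by field_simp; norm_num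
      _ < a / (2 * R) ^ 4 := mul_lt_of_lt_one_right (by positivity) (by norm_num)
      _ ≤ a / dist w q ^ 4 := by gcongr
  · intro w hw
    obtain ⟨h1, h2⟩ := hdist w hw
    rw [hval]
    have h3 : a / dist w q ^ 2 ≤ a / r ^ 2 := by gcongr
    have h4 : a / r ^ 2 = ε := by rw [ha]; field_simp
    have h5 : 0 < a / (4 * R ^ 2) := by positivity
    linarith
  · intro w hw
    obtain ⟨h1, h2⟩ := hdist w hw
    rw [hval]
    rcases h1.lt_or_eq with h1 | h1
    · rcases h2.lt_or_eq with h2 | h2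
      · exact Or.inl ⟨h2, fun h => not_lt.2 (Metric.mem_closedBall.1 h) h1⟩
      · right
        rw [h2, mul_pow, show (2 : ℝ) ^ 2 = 4 by norm_num, add_sub_cancel_right]
        exact hs.le_one _
    · right
      have h4 : a / r ^ 2 = ε := by rw [ha]; field_simp
      have h5 : 0 < a / (4 * R ^ 2) := by positivity
      rw [← h1, h4]
      linarith [hsU w h1.ge]

/-- Uniform strict maximum principle for subsolutions. -/
theorem uniformlyBelow_univ [CompactSpace M]
    (hbd : ∀ x : M, (connectedComponent x ∩ halfPlaneModel.boundary M).Nonempty)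
    (Ω : PositiveForm M) : UniformlyBelow Ω (Set.univ : Set M) := by
  have hopen : IsOpen {y : M | ∃ U ∈ 𝓝 y, UniformlyBelow Ω U} := by
    refine isOpen_iff_mem_nhds.2 fun x ⟨U, hU, h⟩ => ?_
    filter_upwards [eventually_mem_nhds_iff.2 hU] with y hy
    exact ⟨U, hy, h⟩
  have hclosed : IsClosed {y : M | ∃ U ∈ 𝓝 y, UniformlyBelow Ω U} := by
    refine isClosed_of_closure_subset fun x hx => ?_
    by_cases h : x ∈ halfPlaneModel.boundary M
    · exact exists_uniformlyBelow_of_mem_boundary Ω h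
    · exact exists_uniformlyBelow_of_mem_closure Ω h hx
  have hall : ∀ x : M, ∃ U ∈ 𝓝 x, UniformlyBelow Ω U := by
    intro x
    obtain ⟨y, hy, hyb⟩ := hbd x
    -- A clopen set containing a boundary point of the component contains the whole component.
    have h1 := IsClopen.connectedComponent_subset ⟨hclosed, hopen⟩
      (exists_uniformlyBelow_of_mem_boundary Ω hyb)
    rw [← connectedComponent_eq hy] at h1
    exact h1 mem_connectedComponent
  refine isCompact_univ.induction_on ⟨1, one_pos, le_rfl, 1, one_pos, by simp⟩ ?_ ?_ ?_
  · rintro S T hST ⟨ε, hε, hε1, κ, hκ, h⟩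
    exact ⟨ε, hε, hε1, κ, hκ, fun s hs y hy => h s hs y (hST hy)⟩
  · exact fun S T hS hT => hS.union hT
  · intro x _
    obtain ⟨U, hU, h⟩ := hall x
    exact ⟨U, mem_nhdsWithin_of_mem_nhds hU, h⟩

end Subsolution

/-! ### The relative bound of one form with respect to another -/

section RelativeBound

variable {V : Type*} [NormedAddCommGroup V] [InnerProductSpace ℂ V]

/-- The least `t` with `h ≤ t P` as quadratic forms. -/
noncomputable def relBound (P h : V →L[ℂ] V) : ℝ :=
  sInf {t : ℝ | ∀ v, reForm h v ≤ t * reForm P v}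

variable {P h : V →L[ℂ] V}

theorem ContinuousLinearMap.IsPositive.reForm_pos (hP : P.IsPositive) (hu : IsUnit P) {v : V}
    (hv : v ≠ 0) : 0 < reForm P v := by
  have h1 := hP.norm_sq_le hu v
  have h2 : 0 < ‖v‖ ^ 2 := by positivity
  have h3 : 0 ≤ reForm P v := hP.2 v
  refine lt_of_le_of_ne h3 fun h0 => ?_
  rw [← h0, mul_zero] at h1
  linarith

theorem ContinuousLinearMap.IsPositive.reForm_le (hP : P.IsPositive) (hu : IsUnit P)
    (h : V →L[ℂ] V) (v : V) : reForm h v ≤ ‖h‖ * ‖Ring.inverse P‖ * reForm P v :=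
  (le_abs_self _).trans ((abs_reForm_le h v).trans (by
    rw [mul_assoc]
    exact mul_le_mul_of_nonneg_left (hP.norm_sq_le hu v) (norm_nonneg h)))

variable (hP : P.IsPositive) (hu : IsUnit P)

include hP hu

theorem reForm_le_relBound (v : V) : reForm h v ≤ relBound P h * reForm P v := by
  rcases eq_or_ne v 0 with rfl | hv
  · simp [reForm]
  · rw [← div_le_iff₀ (hP.reForm_pos hu hv)]
    refine le_csInf ⟨_, hP.reForm_le hu h⟩ fun t ht => ?_
    rw [div_le_iff₀ (hP.reForm_pos hu hv)]
    exact ht v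

variable [Nontrivial V]

/-- A nonzero vector bounds the admissible `t` from below. On the zero space every `t` is admissible
and the infimum is a default value. -/
theorem relBound_le {t : ℝ} (ht : ∀ v, reForm h v ≤ t * reForm P v) : relBound P h ≤ t := by
  obtain ⟨v, hv⟩ := exists_ne (0 : V)
  refine csInf_le ⟨reForm h v / reForm P v, fun t ht => ?_⟩ ht
  rw [div_le_iff₀ (hP.reForm_pos hu hv)]
  exact ht v

theorem exists_of_lt_relBound {t : ℝ} (ht : t < relBound P h) :
    ∃ v, ‖v‖ = 1 ∧ t * reForm P v < reForm h v := by
  by_contra! hcon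
  refine not_le.2 ht (relBound_le hP hu fun v => ?_)
  rcases eq_or_ne v 0 with rfl | hv
  · simp [reForm]
  · have hv' : ‖v‖ ≠ 0 := norm_ne_zero_iff.2 hv
    have h1 := hcon (((‖v‖⁻¹ : ℝ) : ℂ) • v) (by
      rw [norm_smul, Complex.norm_real, norm_inv, norm_norm, inv_mul_cancel₀ hv'])
    rw [reForm_smul_vec, reForm_smul_vec, mul_left_comm] at h1
    refine le_of_mul_le_mul_left h1 ?_
    rw [Complex.norm_real, norm_inv, norm_norm]
    positivity

/-- Substitutes for an extremal eigenvector, which may fail to exist in infinite dimension. -/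
theorem exists_almost_touching {δ : ℝ} (hδ : 0 < δ) :
    ∃ v, ‖v‖ = 1 ∧ -δ ≤ reForm h v - relBound P h * reForm P v := by
  obtain ⟨v, hv, hlt⟩ := exists_of_lt_relBound (h := h) hP hu
    (t := relBound P h - δ / (‖P‖ + 1)) (sub_lt_self _ (by positivity))
  refine ⟨v, hv, ?_⟩
  have h1 := (le_abs_self _).trans (abs_reForm_le P v)
  rw [hv, one_pow, mul_one] at h1
  have h2 : δ / (‖P‖ + 1) * reForm P v ≤ δ := by
    rw [div_mul_eq_mul_div, div_le_iff₀ (by positivity)]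
    nlinarith
  nlinarith

end RelativeBound

/-- Polarisation: for `w` the multiple of `h v` of norm `‖v‖`, the forms at `v ± w` differ by `4 ‖v‖
‖h v‖`, and the parallelogram law bounds the difference by `4N ‖v‖²`. -/
theorem norm_le_of_abs_reForm_le {V : Type*} [NormedAddCommGroup V] [InnerProductSpace ℂ V]
    [CompleteSpace V] {h : V →L[ℂ] V} (hh : IsSelfAdjoint h) {N : ℝ} (hN : 0 ≤ N)
    (hb : ∀ v, |reForm h v| ≤ N * ‖v‖ ^ 2) : ‖h‖ ≤ N := by
  refine h.opNorm_le_bound hN fun v => ?_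
  rcases eq_or_ne (h v) 0 with h0 | h0
  · rw [h0, norm_zero]; positivity
  have hv : v ≠ 0 := fun h1 => h0 (by rw [h1, map_zero])
  have hvpos : 0 < ‖v‖ := norm_pos_iff.2 hv
  have hhpos : 0 < ‖h v‖ := norm_pos_iff.2 h0
  set r : ℝ := ‖v‖ / ‖h v‖ with hr
  set w : V := (r : ℂ) • h v with hw
  have hwn : ‖w‖ = ‖v‖ := by
    rw [hw, norm_smul, Complex.norm_real, Real.norm_eq_abs, abs_of_pos (by positivity), hr]
    field_simp
  have hpol : reForm h (v + w) - reForm h (v - w) = 4 * (‖v‖ * ‖h v‖) := by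
    have hsymm : (inner ℂ (h w) v).re = (inner ℂ (h v) w).re := by
      have h1 : inner ℂ (h w) v = inner ℂ w (h v) := hh.isSymmetric w v
      rw [h1, ← inner_conj_symm, Complex.conj_re]
    have h2 : (inner ℂ (h v) w).re = ‖v‖ * ‖h v‖ := by
      have h3 : (inner ℂ (h v) (h v)).re = ‖h v‖ ^ 2 := by
        rw [inner_self_eq_norm_sq_to_K]
        norm_cast
      rw [hw, inner_smul_right, Complex.re_ofReal_mul, h3, hr]
      field_simp
    simp only [reForm, map_add, map_sub, inner_add_left, inner_add_right, inner_sub_left,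
      inner_sub_right, Complex.add_re, Complex.sub_re, hsymm, h2]
    ring
  have hpar : ‖v + w‖ ^ 2 + ‖v - w‖ ^ 2 = 4 * ‖v‖ ^ 2 := by
    have := parallelogram_law_with_norm ℂ v w
    rw [hwn] at this
    nlinarith
  have h1 := (abs_le.1 (hb (v + w))).2
  have h2 := (abs_le.1 (hb (v - w))).1
  have h3 : ‖v‖ * ‖h v‖ ≤ ‖v‖ * (N * ‖v‖) := by nlinarith
  exact le_of_mul_le_mul_left h3 hvpos

/-! ### The relative bound as a subsolution, and the estimate -/

section Estimate

theorem norm_le_supNorm {M : Type*} [TopologicalSpace M] [CompactSpace M] {E : Type*}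
    [NormedAddCommGroup E] {f : M → E}
    (hf : Continuous f) (x : M) : ‖f x‖ ≤ supNorm f :=
  le_ciSup (isCompact_range hf.norm).bddAbove x

theorem supNorm_nonneg {M E : Type*} [NormedAddCommGroup E] (f : M → E) : 0 ≤ supNorm f :=
  Real.iSup_nonneg fun x => norm_nonneg (f x)

variable {M : Type*} [TopologicalSpace M] [ChartedSpace ClosedHalfPlane M]

section Neg

variable {E : Type*} [NormedAddCommGroup E] [NormedSpace ℂ E] (f : ℂ → E) {z : ℂ}

theorem dz_neg (hz : z ∈ ℍ₀) : dz (fun w => -f w) z = -dz f z := by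
  rw [dz, dz, fderivWithin_fun_neg (uniqueDiffOn_halfPlane z hz)]
  simp only [_root_.neg_apply]
  module

theorem dzbar_neg (hz : z ∈ ℍ₀) : dzbar (fun w => -f w) z = -dzbar f z := by
  rw [dzbar, dzbar, fderivWithin_fun_neg (uniqueDiffOn_halfPlane z hz)]
  simp only [_root_.neg_apply]
  module

end Neg

variable {V : Type*} [NormedAddCommGroup V] [InnerProductSpace ℂ V] [CompleteSpace V]
  {P h : M → V →L[ℂ] V} {α β : ℝ≥0} {Ω : PositiveForm M}

theorem opL_neg (Ω : PositiveForm M) (P h : M → V →L[ℂ] V) (x : M) :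
    opL Ω P (fun y => -h y) x = -opL Ω P h x := by
  have hz : extChartAt halfPlaneModel x x ∈ ℍ₀ :=
    extend_target_subset_halfPlane (mem_extChartAt_target (I := halfPlaneModel) x)
  set e := chartAt ClosedHalfPlane x
  have h1 : inChart e (fun y => -h y) = fun w => -inChart e h w := rfl
  have h2 : dzbar (dz fun w => -inChart e h w) (extChartAt halfPlaneModel x x) =
      -dzbar (dz (inChart e h)) (extChartAt halfPlaneModel x x) := by
    rw [← dzbar_neg _ hz]
    refine dzbar_congr ?_ hz
    filter_upwards [self_mem_nhdsWithin] with w hw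
    exact dz_neg _ hw
  rw [opL, opL, localL, localL, h1, h2, dz_neg _ hz, dzbar_neg _ hz, ← smul_neg]
  congr 1
  noncomm_ring

-- For `t'` above the bound at `x`, the form `h - t' P` is negative at `x` with a coercive margin,
-- which absorbs a small change in operator norm at nearby points.
omit [ChartedSpace ClosedHalfPlane M] [CompleteSpace V] in
theorem upperSemicontinuous_relBound [Nontrivial V] (hP : Continuous P) (hh : Continuous h)
    (hpos : ∀ x, (P x).IsPositive ∧ IsUnit (P x)) :
    UpperSemicontinuous fun x => relBound (P x) (h x) := by
  intro x t ht
  change relBound (P x) (h x) < t at ht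
  change ∀ᶠ y in 𝓝 x, relBound (P y) (h y) < t
  obtain ⟨t', ht', htt'⟩ := exists_between ht
  set N := ‖Ring.inverse (P x)‖ with hN
  set δ := (t' - relBound (P x) (h x)) / (N + 1) with hδ
  have hδpos : 0 < δ := div_pos (sub_pos.2 ht') (by positivity)
  have hc : Continuous fun y => (h y - (t' : ℂ) • P y) := hh.sub (hP.fun_const_smul _)
  filter_upwards [Metric.continuous_iff'.1 hc x δ hδpos] with y hy
  refine lt_of_le_of_lt (relBound_le (hpos y).1 (hpos y).2 fun v => ?_) htt'
  have h1 := (le_abs_self _).trans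
    (abs_reForm_le ((h y - (t' : ℂ) • P y) - (h x - (t' : ℂ) • P x)) v)
  rw [reForm_sub, reForm_sub, reForm_sub, reForm_real_smul, reForm_real_smul] at h1
  have h2 := reForm_le_relBound (h := h x) (hpos x).1 (hpos x).2 v
  have h3 := (hpos x).1.norm_sq_le (hpos x).2 v
  rw [dist_eq_norm] at hy
  have h4 : ‖(h y - (t' : ℂ) • P y) - (h x - (t' : ℂ) • P x)‖ * ‖v‖ ^ 2 ≤ δ * ‖v‖ ^ 2 := by gcongr
  have h5 : δ * ‖v‖ ^ 2 ≤ δ * (N * reForm (P x) v) := by gcongr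
  have h6 : 0 ≤ reForm (P x) v := (hpos x).1.2 v
  have h7 : δ * (N + 1) = t' - relBound (P x) (h x) := by
    rw [hδ, div_mul_cancel₀ _ (by positivity : N + 1 ≠ 0)]
  have h8 : δ * (N * reForm (P x) v) ≤ (t' - relBound (P x) (h x)) * reForm (P x) v := by
    rw [← h7]
    nlinarith [mul_nonneg hδpos.le h6]
  linarith

/-- The relative bound of `h` with respect to a flat `P` is, after normalisation, a subsolution. -/
theorem isSubsolution_relBound [Nontrivial V] (hP : IsHolderClass 2 α P)
    (hpos : ∀ x, (P x).IsPositive ∧ IsUnit (P x)) (hflat : IsFlat P) (hc : Continuous h)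
    (hh : ∀ e ∈ atlas ClosedHalfPlane M, ∀ z ∈ (e.extend halfPlaneModel).target,
      ContDiffWithinAt ℝ 2 (inChart e h) ℍ₀ z)
    (h0 : ∀ x ∈ halfPlaneModel.boundary M, h x = 0) {c S κ : ℝ} (hS : 0 < S)
    (hc₁ : ∀ x, ‖opL Ω P h x‖ * ‖Ring.inverse (P x)‖ ≤ c) (hcκ : c ≤ κ * S)
    (hle : ∀ x, relBound (P x) (h x) ≤ S) :
    IsSubsolution Ω κ fun x => relBound (P x) (h x) / S where
  usc := by
    have h1 := upperSemicontinuous_relBound hP.continuous hc hpos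
    intro x t ht
    change relBound (P x) (h x) / S < t at ht
    rw [div_lt_iff₀ hS] at ht
    filter_upwards [h1 x _ ht] with y hy
    exact (div_lt_iff₀ hS).2 hy
  le_one x := (div_le_one hS).2 (hle x)
  boundary x hx := by
    refine div_nonpos_of_nonpos_of_nonneg (relBound_le (hpos x).1 (hpos x).2 fun v => ?_) hS.le
    rw [h0 x hx]
    simp [reForm]
  touching p hp F f hF hf htle hteq := by
    set e := chartAt ClosedHalfPlane p with he₀
    have he : e ∈ atlas ClosedHalfPlane M := chart_mem_atlas ClosedHalfPlane p
    have hpe : p ∈ e.source := mem_chart_source ClosedHalfPlane p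
    set z := extChartAt halfPlaneModel p p with hz
    have hzt : z ∈ (e.extend halfPlaneModel).target := mem_extChartAt_target (I := halfPlaneModel) p
    have hzim : 0 < z.im := extChartAt_im_pos hp
    have hPz : inChart e P z = P p := eq_inChart_extend P hpe
    have hhz : inChart e h z = h p := eq_inChart_extend h hpe
    have hg : 0 < Ω.coeff e z := Ω.pos e he z hzt
    have hval : ∀ u, ((S : ℂ) * F u).re - ‖(Real.sqrt S : ℂ) * f u‖ ^ 2 =
        S * ((F u).re - ‖f u‖ ^ 2) := fun u => by
      rw [Complex.re_ofReal_mul, norm_mul, mul_pow, Complex.norm_real, Real.norm_eq_abs, sq_abs,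
        Real.sq_sqrt hS.le]
      ring
    have hfl : dzbar (dz (inChart e P)) z =
        dzbar (inChart e P) z * Ring.inverse (inChart e P z) * dz (inChart e P) z := by
      have h1 := hflat e he z hzt hzim
      rw [curvatureCoeff] at h1
      have h2 := congrArg (fun T => inChart e P z * T) h1
      simp only [← mul_assoc, mul_zero] at h2
      rw [Ring.mul_inverse_cancel _ (hPz ▸ (hpos p).2), one_mul] at h2
      exact sub_eq_zero.1 h2
    -- Undoing the normalisation by `S` multiplies the test function by `S`; this keeps its shape
    -- when `F` is scaled by `S` and `f` by `√S`.
    have key := norm_deriv_sq_le_of_touching (c := c * Ω.coeff e z) hzim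
      (hP.contDiffWithinAt he hzt) (hh e he z hzt)
      (Filter.Eventually.of_forall fun w => (hpos _).1.isSelfAdjoint) (hPz ▸ (hpos p).1)
      (hPz ▸ (hpos p).2) hfl (F := fun u => (S : ℂ) * F u) (f := fun u => (Real.sqrt S : ℂ) * f u)
      (analyticAt_const.mul hF) (analyticAt_const.mul hf) ?_ ?_ ?_
    · have hd : deriv (fun u => (Real.sqrt S : ℂ) * f u) z = Real.sqrt S * deriv f z :=
        deriv_const_mul _ hf.differentiableAt
      rw [hd, norm_mul, mul_pow, Complex.norm_real, Real.norm_eq_abs, sq_abs,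
        Real.sq_sqrt hS.le] at key
      have h1 : c * Ω.coeff e z ≤ κ * S * Ω.coeff e z := by gcongr
      refine le_of_mul_le_mul_left ?_ hS
      linarith
    · intro v
      change _ ≤ reForm (localL e P h z) v
      have hloc : localL e P h z = ((Ω.coeff e z : ℝ) : ℂ) • opL Ω P h p := by
        change _ = _ • ((1 / Ω.coeff e z : ℝ) : ℂ) • localL e P h z
        rw [smul_smul, ← Complex.ofReal_mul, mul_one_div_cancel hg.ne',
          Complex.ofReal_one, one_smul]
      rw [hloc, reForm_real_smul, hPz]
      have h1 := (hpos p).1.reForm_le (hpos p).2 (-opL Ω P h p) v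
      rw [reForm_neg, norm_neg] at h1
      have h2 : 0 ≤ reForm (P p) v := (hpos p).1.2 v
      have h3 : -reForm (opL Ω P h p) v ≤ c * reForm (P p) v :=
        h1.trans (mul_le_mul_of_nonneg_right (hc₁ p) h2)
      nlinarith
    · have ht : Filter.Tendsto (e.extend halfPlaneModel).symm (𝓝[ℍ₀] z) (𝓝 p) := by
        have h1 := (e.continuousAt_extend_symm (I := halfPlaneModel) hpe).tendsto
        rw [e.extend_left_inv hpe] at h1
        exact h1.mono_left nhdsWithin_le_nhds
      filter_upwards [ht.eventually htle, extend_target_mem_nhdsWithin_halfPlane hzt]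
        with w hw hwt v
      have hinv : extChartAt halfPlaneModel p ((e.extend halfPlaneModel).symm w) = w :=
        (e.extend halfPlaneModel).right_inv hwt
      rw [hinv, div_le_iff₀ hS] at hw
      rw [hval]
      set y := (e.extend halfPlaneModel).symm w
      have h2 := reForm_le_relBound (h := h y) (hpos y).1 (hpos y).2 v
      refine h2.trans (mul_le_mul_of_nonneg_right ?_ ((hpos y).1.2 v))
      linarith
    · intro δ hδ
      obtain ⟨v, hv, hvδ⟩ := exists_almost_touching (h := h p) (hpos p).1 (hpos p).2 hδ
      refine ⟨v, hv, ?_⟩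
      rw [hval, hPz, hhz, ← hteq, mul_div_cancel₀ _ hS.ne']
      exact hvδ

/-- If the maximum `S` exceeded `c/κ`, dividing by `S` would give a subsolution with constant `κ`
that attains `1`, against the uniform bound `1 - ε`. -/
theorem relBound_le_of_uniformlyBelow [CompactSpace M] [Nontrivial V] {ε κ : ℝ} (hε : 0 < ε)
    (hκ : 0 < κ) (hUB : ∀ s, IsSubsolution Ω κ s → ∀ y : M, s y ≤ 1 - ε)
    (hP : IsHolderClass 2 α P)
    (hpos : ∀ x, (P x).IsPositive ∧ IsUnit (P x)) (hflat : IsFlat P) (hc : Continuous h)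
    (hh : ∀ e ∈ atlas ClosedHalfPlane M, ∀ z ∈ (e.extend halfPlaneModel).target,
      ContDiffWithinAt ℝ 2 (inChart e h) ℍ₀ z)
    (h0 : ∀ x ∈ halfPlaneModel.boundary M, h x = 0) {c : ℝ} (hc0 : 0 ≤ c)
    (hc₁ : ∀ x, ‖opL Ω P h x‖ * ‖Ring.inverse (P x)‖ ≤ c) (x : M) :
    relBound (P x) (h x) ≤ c / κ := by
  by_contra! hlt
  have husc := (upperSemicontinuous_relBound hP.continuous hc hpos).upperSemicontinuousOn Set.univ
  obtain ⟨y, _, hy⟩ := husc.exists_isMaxOn ⟨x, Set.mem_univ x⟩ isCompact_univ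
  have hmax : ∀ u, relBound (P u) (h u) ≤ relBound (P y) (h y) := fun u => hy (Set.mem_univ u)
  have hlt' : c / κ < relBound (P y) (h y) := hlt.trans_le (hmax x)
  have hS : 0 < relBound (P y) (h y) := (div_nonneg hc0 hκ.le).trans_lt hlt'
  rw [div_lt_iff₀ hκ] at hlt'
  have h1 := hUB _ (isSubsolution_relBound hP hpos hflat hc hh h0 hS hc₁
    (by rw [mul_comm]; exact hlt'.le) hmax) y
  rw [div_self hS.ne'] at h1
  linarith

end Estimate

theorem theorem3p4 {M : Type*} [TopologicalSpace M] [T2Space M] [CompactSpace M]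
    [ChartedSpace ClosedHalfPlane M] [IsManifold halfPlaneModel ω M]
    (hbd : ∀ x : M, (connectedComponent x ∩ halfPlaneModel.boundary M).Nonempty)
    (Ω : PositiveForm M) :
    ∃ C : ℝ → ℝ → ℝ,
      ∀ (V : Type*) [NormedAddCommGroup V] [InnerProductSpace ℂ V] [CompleteSpace V]
        (α : ℝ≥0), 0 < α → α < 1 →
        ∀ P : M → V →L[ℂ] V, IsHolderClass 2 α P →
          (∀ x, (P x).IsPositive ∧ IsUnit (P x)) → IsFlat P →
          ∀ h : M → V →L[ℂ] V, IsHolderClass 2 α h →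
            (∀ x, IsSelfAdjoint (h x)) → (∀ x ∈ halfPlaneModel.boundary M, h x = 0) →
            supNorm h ≤ C (supNorm P) (supNorm fun x => Ring.inverse (P x)) *
              supNorm (opL Ω P h) := by
  obtain ⟨ε, hε, -, κ, hκ, hUB⟩ := uniformlyBelow_univ hbd Ω
  refine ⟨fun a b => a * b / κ, fun V _ _ _ α _ _ P hP hpos hflat h hh hsa h0 => ?_⟩
  have hPn := supNorm_nonneg P
  have hIn := supNorm_nonneg fun x => Ring.inverse (P x)
  have hLn := supNorm_nonneg (opL Ω P h)
  refine Real.iSup_le (fun x => ?_) (by positivity)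
  rcases subsingleton_or_nontrivial V with hV | hV
  · rw [Subsingleton.elim (h x) 0, norm_zero]
    positivity
  have hPc := hP.continuous
  have hhc := hh.continuous
  have hIc : Continuous fun x => Ring.inverse (P x) := continuous_iff_continuousAt.2 fun x => by
    obtain ⟨u, hu⟩ := (hpos x).2
    have h1 := NormedRing.inverse_continuousAt u
    rw [hu] at h1
    exact ContinuousAt.comp (f := P) h1 hPc.continuousAt
  have hLc := continuous_opL Ω hP (fun x => (hpos x).2) hh
  set c := supNorm (opL Ω P h) * supNorm fun x => Ring.inverse (P x) with hcdef
  have hc0 : 0 ≤ c := mul_nonneg hLn hIn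
  have hc₁ : ∀ x, ‖opL Ω P h x‖ * ‖Ring.inverse (P x)‖ ≤ c := fun x =>
    mul_le_mul (norm_le_supNorm hLc x) (norm_le_supNorm hIc x) (norm_nonneg _) hLn
  have hUB' : ∀ s, IsSubsolution Ω κ s → ∀ y : M, s y ≤ 1 - ε := fun s hs y =>
    hUB s hs y (Set.mem_univ y)
  have hup := relBound_le_of_uniformlyBelow hε hκ hUB' hP hpos hflat hhc
    (fun e he z hz => hh.contDiffWithinAt he hz) h0 hc0 hc₁ x
  -- The operator is linear in `h`, so the same constant `c` serves for `-h` and yields the lower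
  -- bound.
  have hlow := relBound_le_of_uniformlyBelow (h := fun y => -h y) hε hκ hUB' hP hpos hflat hhc.neg
    (fun e he z hz => (hh.contDiffWithinAt he hz).neg) (fun y hy => by rw [h0 y hy, neg_zero]) hc0
    (fun y => by rw [opL_neg, norm_neg]; exact hc₁ y) x
  have hPx : ∀ v, reForm (P x) v ≤ supNorm P * ‖v‖ ^ 2 := fun v =>
    (le_abs_self _).trans ((abs_reForm_le _ v).trans (by gcongr; exact norm_le_supNorm hPc x))
  have hκ0 : 0 ≤ c / κ := div_nonneg hc0 hκ.le
  have hbound : ‖h x‖ ≤ c / κ * supNorm P := by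
    refine norm_le_of_abs_reForm_le (hsa x) (mul_nonneg hκ0 hPn) fun v => ?_
    have hv0 : 0 ≤ reForm (P x) v := (hpos x).1.2 v
    have h1 := reForm_le_relBound (h := h x) (hpos x).1 (hpos x).2 v
    have h2 := reForm_le_relBound (h := -h x) (hpos x).1 (hpos x).2 v
    rw [reForm_neg] at h2
    have h3 : c / κ * reForm (P x) v ≤ c / κ * supNorm P * ‖v‖ ^ 2 := by
      rw [mul_assoc]
      exact mul_le_mul_of_nonneg_left (hPx v) hκ0
    have h4 := mul_le_mul_of_nonneg_right hup hv0
    have h5 := mul_le_mul_of_nonneg_right hlow hv0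
    exact abs_le.2 ⟨by linarith, by linarith⟩
  refine hbound.trans (le_of_eq ?_)
  rw [hcdef]
  ring
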